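/- **Base.** Let $f$ be a homeomorphism of a compact metric space $X$ such that $(X,f)$ is one of the following, with contraction rate $\lambda\in(0,1)$, stable leaves $W^s(x)$ and local stable leaves $W^s_{loc}(x)$. 1. *Partially hyperbolic diffeomorphism* (Anosov diffeomorphisms included): $X$ is a compact connected manifold with the distance of a Riemannian metric, $f$ is a $C^1$ diffeomorphism, there are a $Df$-invariant splitting $TX=E^s\oplus E^c\oplus E^u$ with $E^s,E^u\ne0$ and positive continuous functions $\lambda(\cdot)<1$, $\hat\lambda(\cdot)<1$, $\xi,\hat\xi$ such that for all $x$ and all unit vectors $v^s,v^c,v^u$ in $E^s(x),E^c(x),E^u(x)$ $$\|Df_x v^s\|<\lambda(x)<\xi(x)<\|Df_x v^c\|<\hat\xi(x)^{-1}<\hat\lambda(x)^{-1}<\|Df_x v^u\|$$ (if $E^c=0$, the relations with $v^c$ are void). Put $\lambda=\max_x\lambda(x)$. $W^s(x)$ is the stable leaf of $x$ (the points joined to $x$ by $C^1$ curves tangent to $E^s$), and $W^s_{loc}(x)$ is the ball about $x$ in $W^s(x)$, for the length distance of the leaf, of a radius $\rho_0>0$ fixed so small that $$d_X(f^nx,f^ny)\le\lambda^n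 d_X(x,y)\quad\text{for all } x\in X,\ y\in W^s_{loc}(x),\ n\in\mathbb N.\tag{1}$$ 2. *Hyperbolic set*: $X$ is a compact hyperbolic set of a $C^1$ diffeomorphism between open subsets of a Riemannian manifold, with the induced distance, and $f$ is the restriction to $X$; the splitting is $E^s\oplus E^u$ over $X$, with $\|Df_xv^s\|<\lambda(x)<1$ and $1<\hat\lambda(x)^{-1}<\|Df_xv^u\|$ for unit vectors, where $\lambda(\cdot),\hat\lambda(\cdot)$ are positive and continuous, and $\lambda=\max_x\lambda(x)$. Here $W^s(x)=\{y\in X: d_X(f^nx,f^ny)\to0\}$ and $W^s_{loc}(x)=\{y\in X: d_X(f^nx,f^ny)\le\varepsilon\ \forall n\ge0\}$ with $\varepsilon>0$ fixed so small that (1) holds. 3. *Two-sided subshift of finite type*, with $d_X(x,y)=\lambda^{\min\{|i|:\,x_i\ne y_i\}}$ for $x\neq y$; $W^s(x)$ is the set of sequences agreeing with $x$ at all sufficiently large $i$, and $W^s_{loc}(x)$ the set of those agreeing with $x$ at all $i\ge0$. **Fiber.** Let $\mathcal M$ be a compact smooth manifold. Fix a smooth embedding $e:\mathcal M\to\mathbb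 R^N$ and finitely many charts $\varphi_c$ with closed balls $B_c$ in their images such that the preimages of the open balls cover $\mathcal M$. For $s=k+\alpha$ with $k\in\mathbb N=\{1,2,\dots\}$ and $0\le\alpha\le1$ (here $s=k+1$ with $\alpha=1$ stands for $C^{k,1}$: Lipschitz derivatives of order $k$), and $u:\mathcal M\to\mathbb R^N$, let $$[u]_{s}=\max_{1\le i\le k}\max_c\sup_{B_c}\|D^i(u\circ\varphi_c^{-1})\|+\max_c\sup_{v\ne w\in B_c}\frac{\|D^k_v(u\circ\varphi_c^{-1})-D^k_w(u\circ\varphi_c^{-1})\|}{|v-w|^{\alpha}},$$ where the last term is omitted if $\alpha=0$, and $\|u\|_{C^s}=\sup|u|+[u]_s$. For $g:\mathcal M\to\mathcal M$ let $\|g\|_{C^s}=\sup_t|e(g(t))-e(t)|+[e\circ g]_s$. $\mathrm{Diff}^s(\mathcal M)$ is the group of homeomorphisms $g$ such that $g,g^{-1}$ are $C^k$ and $|g|_{C^s}:=\|g\|_{C^s}+\|g^{-1}\|_{C^s}<\infty$, with the distance $$d_{C^s}(g,h)=\|e\circ g-e\circ h\|_{C^s}+\|e\circ g^{-1}-e\circ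 h^{-1}\|_{C^s}.$$ **Proposition.** Let $k\in\mathbb N$, $q=k+\gamma$ with $0<\gamma\le1$ (for $\gamma=1$, $C^q$ means $C^{k,1}$), $k\le r<q$, $\rho=q-r$ and $0<\beta\le1$. In norms and distances of order $r$ write $r=k+\alpha$ with $\alpha=r-k\in[0,\gamma)$. Let $A:X\to\mathrm{Diff}^q(\mathcal M)$ satisfy $d_{C^q}(A_x,A_y)\le c\,d_X(x,y)^\beta$ for all $x,y\in X$ and some constant $c$, and let $\mathcal A^n_x=A_{f^{n-1}x}\circ\cdots\circ A_x$, $\mathcal A^0_x=\mathrm{Id}$. Suppose that there are constants $\eta>0$ and $K$ such that $$\eta^{2(r+1)}\lambda^{\beta\rho}<1\quad\text{and}\quad|\mathcal A^n_x|_{C^q}\le K\eta^n\ \text{ for all }x\in X,\ n\in\mathbb N.$$ Then for all $x\in X$ and $y\in W^s(x)$ the limit $H_{x,y}=\lim_{n\to+\infty}(\mathcal A^n_y)^{-1}\circ\mathcal A^n_x$ exists in $\mathrm{Diff}^r(\mathcal M)$, and * (H1) $H_{x,x}=\mathrm{Id}$, $H_{y,z}\circ H_{x,y}=H_{x,z}$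 and $(H_{x,y})^{-1}=H_{y,x}$ for all $x\in X$ and $y,z\in W^s(x)$; * (H2) $H_{x,y}=(\mathcal A^n_y)^{-1}\circ H_{f^nx,f^ny}\circ\mathcal A^n_x$ for all $x\in X$, $y\in W^s(x)$, $n\ge0$; * (H3) there is a constant $c_1$ such that $d_{C^r}(H_{x,y},\mathrm{Id})\le c_1\,d_X(x,y)^{\beta\rho}$ for all $x\in X$ and $y\in W^s_{loc}(x)$; * (H4) the map $(x,y)\mapsto H_{x,y}$ into $\mathrm{Diff}^r(\mathcal M)$ is continuous on $\{(x,y):x\in X,\ y\in W^s_{loc}(x)\}$. -/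

import Mathlib

open Set Filter Topology Manifold Bundle
open scoped ENNReal ContDiff

universe u v

noncomputable section

/-! ## The fiber: `C^r` norms, distances and diffeomorphisms of a compact manifold -/

/-- Auxiliary data used to write down the `C^r` norms on a compact manifold `M`: finitely many
charts, in each of them a closed ball such that the corresponding open balls cover `M`, and a
smooth embedding of `M` in a Euclidean space (which makes differences of maps into `M`
meaningful).  Different choices give norms that are equivalent up to multiplicative constants. -/
structure NormData (d : ℕ) (M : Type v) [TopologicalSpace M]
    [ChartedSpace (EuclideanSpace ℝ (Fin d)) M] where
  /-- centers of the charts -/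
  centers : Finset M
  /-- radii of the balls in the charts -/
  radius : M → ℝ
  closedBall_subset : ∀ c ∈ centers,
    Metric.closedBall (extChartAt (𝓡 d) c c) (radius c) ⊆ (extChartAt (𝓡 d) c).target
  covers : ∀ t : M, ∃ c ∈ centers, t ∈ (extChartAt (𝓡 d) c).source ∧
    extChartAt (𝓡 d) c t ∈ Metric.ball (extChartAt (𝓡 d) c c) (radius c)
  /-- dimension of the ambient Euclidean space -/
  dim : ℕ
  /-- the embedding -/
  emb : M → EuclideanSpace ℝ (Fin dim)
  emb_smooth : ContMDiff (𝓡 d) (𝓡 dim) ∞ emb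
  emb_injective : Function.Injective emb
  emb_immersion : ∀ t : M, Function.Injective (mfderiv (𝓡 d) (𝓡 dim) emb t)

namespace NormData

variable {d : ℕ} {M : Type v} [TopologicalSpace M] [ChartedSpace (EuclideanSpace ℝ (Fin d)) M]

/-- The closed ball in the chart centered at `c`. -/
def chartBall (D : NormData d M) (c : M) : Set (EuclideanSpace ℝ (Fin d)) :=
  Metric.closedBall (extChartAt (𝓡 d) c c) (D.radius c)

/-- The derivative of order `i` of `u`, read in the chart centered at `c`. -/
def chartDeriv (D : NormData d M) (u : M → EuclideanSpace ℝ (Fin D.dim)) (i : ℕ) (c : M) :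
    EuclideanSpace ℝ (Fin d) → (EuclideanSpace ℝ (Fin d)) [×i]→L[ℝ] EuclideanSpace ℝ (Fin D.dim) :=
  iteratedFDeriv ℝ i (u ∘ (extChartAt (𝓡 d) c).symm)

/-- The part of the `C^{k+α}` norm that involves derivatives: the sup norms of the derivatives of
orders `1, …, k` and, if `α > 0`, the `α`-Hölder seminorm of the derivative of order `k`
(`α = 1` means Lipschitz). -/
def derivNorm (D : NormData d M) (k : ℕ) (α : ℝ) (u : M → EuclideanSpace ℝ (Fin D.dim)) : ℝ≥0∞ :=
  (⨆ i ∈ Finset.Icc 1 k, ⨆ c ∈ D.centers, ⨆ v ∈ D.chartBall c, ‖D.chartDeriv u i c v‖ₑ) +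
  if α = 0 then 0 else
    ⨆ c ∈ D.centers, ⨆ v ∈ D.chartBall c, ⨆ w ∈ D.chartBall c, ⨆ _ : v ≠ w,
      ‖D.chartDeriv u k c v - D.chartDeriv u k c w‖ₑ / edist v w ^ α

/-- The `C^{k+α}` norm of a map from `M` to the ambient Euclidean space. -/
def vecNorm (D : NormData d M) (k : ℕ) (α : ℝ) (u : M → EuclideanSpace ℝ (Fin D.dim)) : ℝ≥0∞ :=
  (⨆ t : M, ‖u t‖ₑ) + D.derivNorm k α u

/-- `‖g‖_{C^{k+α}}` for a map `g : M → M`; its `C^0` part is the largest displacement. -/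
def mapNorm (D : NormData d M) (k : ℕ) (α : ℝ) (g : M → M) : ℝ≥0∞ :=
  (⨆ t : M, edist (D.emb (g t)) (D.emb t)) + D.derivNorm k α (D.emb ∘ g)

/-- The `C^{k+α}` size `|g|_{C^{k+α}} = ‖g‖_{C^{k+α}} + ‖g⁻¹‖_{C^{k+α}}`. -/
def size (D : NormData d M) (k : ℕ) (α : ℝ) (g : M ≃ₜ M) : ℝ≥0∞ :=
  D.mapNorm k α g + D.mapNorm k α g.symm

/-- The distance `‖g - h‖_{C^{k+α}} + ‖g⁻¹ - h⁻¹‖_{C^{k+α}}` on `Diff^{k+α}(M)`. -/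
def diffDist (D : NormData d M) (k : ℕ) (α : ℝ) (g h : M ≃ₜ M) : ℝ≥0∞ :=
  D.vecNorm k α (fun t => D.emb (g t) - D.emb (h t)) +
  D.vecNorm k α (fun t => D.emb (g.symm t) - D.emb (h.symm t))

/-- `g ∈ Diff^{k+α}(M)`: both `g` and `g⁻¹` are `C^k` and, if `α > 0`, have `α`-Hölder derivatives
of order `k` (Lipschitz if `α = 1`). -/
structure MemDiff (D : NormData d M) (k : ℕ) (α : ℝ) (g : M ≃ₜ M) : Prop where
  contMDiff : ContMDiff (𝓡 d) (𝓡 d) k g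
  contMDiff_symm : ContMDiff (𝓡 d) (𝓡 d) k g.symm
  size_lt_top : D.size k α g < ⊤

end NormData

/-! ## Cocycles -/

/-- The iterates `A^n_x = A (f^{n-1} x) ∘ ⋯ ∘ A (f x) ∘ A x` of the cocycle over `f` generated
by `A`. -/
def cocycleIter {X : Type u} {M : Type v} [TopologicalSpace M]
    (f : X → X) (A : X → M ≃ₜ M) : ℕ → X → M ≃ₜ M
  | 0, _ => 1
  | n + 1, x => A (f^[n] x) * cocycleIter f A n x

/-! ## The base: partially hyperbolic and hyperbolic systems -/

/-- The sets `Wloc x` satisfy `d (f^n x, f^n y) ≤ λ^n d (x, y)` for all `y ∈ Wloc x`. -/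
def ContractsLocally {X : Type u} [MetricSpace X] (f : X → X) (lam : ℝ) (Wloc : X → Set X) :
    Prop :=
  ∀ x, ∀ y ∈ Wloc x, ∀ n : ℕ, dist (f^[n] x) (f^[n] y) ≤ lam ^ n * dist x y

section Manifold

variable {m : ℕ} {X : Type u} [MetricSpace X] [ChartedSpace (EuclideanSpace ℝ (Fin m)) X]
  [IsManifold (𝓡 m) ∞ X] [RiemannianBundle (fun x : X => TangentSpace (𝓡 m) x)]

/-- `f` is a partially hyperbolic diffeomorphism with (nontrivial, `Df`-invariant) splitting
`TX = E^s ⊕ E^c ⊕ E^u` and rates `λ(x) = ls x`, `λ̂(x) = lu x`, `ξ(x) = xs x`, `ξ̂(x) = xu x`.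
The center bundle may be zero, in which case `f` is Anosov. -/
structure IsPartiallyHyperbolic (f : X ≃ₜ X)
    (Es Ec Eu : ∀ x : X, Submodule ℝ (TangentSpace (𝓡 m) x)) (ls lu xs xu : X → ℝ) : Prop where
  contMDiff : ContMDiff (𝓡 m) (𝓡 m) 1 f
  contMDiff_symm : ContMDiff (𝓡 m) (𝓡 m) 1 f.symm
  splitting : ∀ x, DirectSum.IsInternal
    (![Es x, Ec x, Eu x] : Fin 3 → Submodule ℝ (TangentSpace (𝓡 m) x))
  stable_nontrivial : ∀ x, Es x ≠ ⊥
  unstable_nontrivial : ∀ x, Eu x ≠ ⊥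
  map_stable : ∀ x, (Es x).map (mfderiv (𝓡 m) (𝓡 m) f x).toLinearMap = Es (f x)
  map_center : ∀ x, (Ec x).map (mfderiv (𝓡 m) (𝓡 m) f x).toLinearMap = Ec (f x)
  map_unstable : ∀ x, (Eu x).map (mfderiv (𝓡 m) (𝓡 m) f x).toLinearMap = Eu (f x)
  continuous_rates : Continuous ls ∧ Continuous lu ∧ Continuous xs ∧ Continuous xu
  pos_rates : ∀ x, 0 < ls x ∧ 0 < lu x ∧ 0 < xs x ∧ 0 < xu x
  rates_lt_one : ∀ x, ls x < 1 ∧ lu x < 1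
  rates_lt : ∀ x, ls x < xs x ∧ (xu x)⁻¹ < (lu x)⁻¹
  bound_stable : ∀ x, ∀ w ∈ Es x, ‖w‖ = 1 → ‖mfderiv (𝓡 m) (𝓡 m) f x w‖ < ls x
  bound_center : ∀ x, ∀ w ∈ Ec x, ‖w‖ = 1 →
    xs x < ‖mfderiv (𝓡 m) (𝓡 m) f x w‖ ∧ ‖mfderiv (𝓡 m) (𝓡 m) f x w‖ < (xu x)⁻¹
  bound_unstable : ∀ x, ∀ w ∈ Eu x, ‖w‖ = 1 → (lu x)⁻¹ < ‖mfderiv (𝓡 m) (𝓡 m) f x w‖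

/-- `γ : [0, 1] → X` is a `C^1` curve from `x` to `y` tangent to the distribution `Es`. -/
structure IsTangentCurve (Es : ∀ x : X, Submodule ℝ (TangentSpace (𝓡 m) x)) (x y : X)
    (γ : ℝ → X) : Prop where
  contMDiffOn : ContMDiffOn 𝓘(ℝ, ℝ) (𝓡 m) 1 γ (Icc 0 1)
  source : γ 0 = x
  target : γ 1 = y
  tangent : ∀ s ∈ Icc (0 : ℝ) 1,
    (mfderivWithin 𝓘(ℝ, ℝ) (𝓡 m) γ (Icc 0 1) s : ℝ →L[ℝ] TangentSpace (𝓡 m) (γ s)) 1 ∈ Es (γ s)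

/-- The leaf through `x` of the foliation tangent to `Es`: the points that can be reached from `x`
by a curve tangent to `Es`. -/
def leaf (Es : ∀ x : X, Submodule ℝ (TangentSpace (𝓡 m) x)) (x : X) : Set X :=
  {y | ∃ γ : ℝ → X, IsTangentCurve Es x y γ}

/-- The ball of radius `ρ` about `x` in its leaf, with respect to the length distance of the
leaf. -/
def leafBall (Es : ∀ x : X, Submodule ℝ (TangentSpace (𝓡 m) x)) (ρ : ℝ) (x : X) : Set X :=
  {y | ∃ γ : ℝ → X, IsTangentCurve Es x y γ ∧ pathELength (𝓡 m) γ 0 1 < ENNReal.ofReal ρ}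

/-- The isometrically embedded set `ι(X)` is a hyperbolic set of `F`, a `C^1` diffeomorphism of an
open neighborhood `U` of `ι(X)` onto its image in the Riemannian manifold `N`, with splitting
`T_pN = E^s ⊕ E^u` for `p ∈ ι(X)` (the values of `Es`, `Eu` off `ι(X)` are irrelevant) and rates
`λ(x) = ls x`, `λ̂(x) = lu x`; and `f` is the restriction of `F` to this set. -/
structure IsHyperbolicSet {N : Type u} [MetricSpace N]
    [ChartedSpace (EuclideanSpace ℝ (Fin m)) N] [IsManifold (𝓡 m) ∞ N]
    [RiemannianBundle (fun x : N => TangentSpace (𝓡 m) x)] {X : Type u} [MetricSpace X]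
    (F : N → N) (U : Set N) (ι : X → N) (f : X ≃ₜ X)
    (Es Eu : ∀ p : N, Submodule ℝ (TangentSpace (𝓡 m) p)) (ls lu : X → ℝ) : Prop where
  isOpen : IsOpen U
  contMDiffOn : ContMDiffOn (𝓡 m) (𝓡 m) 1 F U
  injOn : InjOn F U
  bijective_mfderiv : ∀ p ∈ U, Function.Bijective (mfderiv (𝓡 m) (𝓡 m) F p)
  isometry : Isometry ι
  mem : ∀ x, ι x ∈ U
  semiconj : ∀ x, F (ι x) = ι (f x)
  splitting : ∀ x, IsCompl (Es (ι x)) (Eu (ι x))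
  map_stable : ∀ x, (Es (ι x)).map (mfderiv (𝓡 m) (𝓡 m) F (ι x)).toLinearMap = Es (F (ι x))
  map_unstable : ∀ x, (Eu (ι x)).map (mfderiv (𝓡 m) (𝓡 m) F (ι x)).toLinearMap = Eu (F (ι x))
  continuous_rates : Continuous ls ∧ Continuous lu
  pos_rates : ∀ x, 0 < ls x ∧ 0 < lu x
  rates_lt_one : ∀ x, ls x < 1 ∧ lu x < 1
  bound_stable : ∀ x, ∀ w ∈ Es (ι x), ‖w‖ = 1 → ‖mfderiv (𝓡 m) (𝓡 m) F (ι x) w‖ < ls x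
  bound_unstable : ∀ x, ∀ w ∈ Eu (ι x), ‖w‖ = 1 →
    (lu x)⁻¹ < ‖mfderiv (𝓡 m) (𝓡 m) F (ι x) w‖

end Manifold

/-- `f` is a partially hyperbolic diffeomorphism of a compact connected manifold whose distance
comes from the Riemannian metric in the definition of partial hyperbolicity, `lam` is the maximum
of `λ(x)`, `Ws x` is the leaf of the stable foliation, and `Wloc x` is the ball about `x` in the
stable leaf of a radius `ρ` so small that `f` contracts local stable leaves. -/
def PartiallyHyperbolicBase {X : Type u} [MetricSpace X] (f : X ≃ₜ X) (lam : ℝ)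
    (Ws Wloc : X → Set X) : Prop :=
  ∃ (m : ℕ) (_ : ChartedSpace (EuclideanSpace ℝ (Fin m)) X) (_ : IsManifold (𝓡 m) ∞ X)
    (_ : RiemannianBundle (fun x : X => TangentSpace (𝓡 m) x))
    (_ : IsContMDiffRiemannianBundle (𝓡 m) ∞ (EuclideanSpace ℝ (Fin m))
      (fun x : X => TangentSpace (𝓡 m) x))
    (_ : IsRiemannianManifold (𝓡 m) X)
    (Es Ec Eu : ∀ x : X, Submodule ℝ (TangentSpace (𝓡 m) x)) (ls lu xs xu : X → ℝ) (ρ : ℝ),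
    CompactSpace X ∧ ConnectedSpace X ∧ IsPartiallyHyperbolic f Es Ec Eu ls lu xs xu ∧
    IsGreatest (range ls) lam ∧ Ws = leaf Es ∧
    0 < ρ ∧ Wloc = leafBall Es ρ ∧ ContractsLocally f lam Wloc

/-- `f` is the restriction of a diffeomorphism to a compact hyperbolic set, `lam` is the maximum of
`λ(x)`, `Ws x` is the stable set of `x`, and `Wloc x` is the local stable set of a size `ε` so small
that `f` contracts local stable sets. -/
def HyperbolicSetBase {X : Type u} [MetricSpace X] (f : X ≃ₜ X) (lam : ℝ)
    (Ws Wloc : X → Set X) : Prop :=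
  ∃ (m : ℕ) (N : Type u) (_ : MetricSpace N) (_ : ChartedSpace (EuclideanSpace ℝ (Fin m)) N)
    (_ : IsManifold (𝓡 m) ∞ N) (_ : RiemannianBundle (fun p : N => TangentSpace (𝓡 m) p))
    (_ : IsContMDiffRiemannianBundle (𝓡 m) ∞ (EuclideanSpace ℝ (Fin m))
      (fun p : N => TangentSpace (𝓡 m) p))
    (_ : IsRiemannianManifold (𝓡 m) N)
    (F : N → N) (U : Set N) (ι : X → N)
    (Es Eu : ∀ p : N, Submodule ℝ (TangentSpace (𝓡 m) p)) (ls lu : X → ℝ) (ε : ℝ),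
    CompactSpace X ∧ IsHyperbolicSet F U ι f Es Eu ls lu ∧ IsGreatest (range ls) lam ∧
    (∀ x, Ws x = {y | Tendsto (fun n : ℕ => dist (f^[n] x) (f^[n] y)) atTop (𝓝 0)}) ∧
    0 < ε ∧ (∀ x, Wloc x = {y | ∀ n : ℕ, dist (f^[n] x) (f^[n] y) ≤ ε}) ∧
    ContractsLocally f lam Wloc

/-- `(X, f)` is (via the coding `e`) a two-sided subshift of finite type with transition rule `T`,
with the metric `d (x, y) = lam ^ min {|i| : x_i ≠ y_i}`, `Ws x` consists of the sequences that
eventually agree with `x`, and `Wloc x` of those that agree with `x` at all `i ≥ 0`. -/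
def SubshiftBase {X : Type u} [MetricSpace X] (f : X ≃ₜ X) (lam : ℝ)
    (Ws Wloc : X → Set X) : Prop :=
  ∃ (l : ℕ) (T : Fin l → Fin l → Prop) (e : X → ℤ → Fin l),
    0 < lam ∧ lam < 1 ∧ Function.Injective e ∧ range e = {a | ∀ i, T (a i) (a (i + 1))} ∧
    (∀ x i, e (f x) i = e x (i + 1)) ∧
    (∀ x y, x ≠ y → dist x y = lam ^ sInf {n : ℕ | ∃ i : ℤ, i.natAbs = n ∧ e x i ≠ e y i}) ∧
    (∀ x, Ws x = {y | ∃ n : ℤ, ∀ i ≥ n, e y i = e x i}) ∧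
    (∀ x, Wloc x = {y | ∀ i ≥ (0 : ℤ), e y i = e x i})

/-- `(X, f)` is a partially hyperbolic or hyperbolic system with contraction rate `lam` along the
stable leaves, stable leaves `Ws x` and local stable leaves `Wloc x`.  (Anosov diffeomorphisms are
partially hyperbolic diffeomorphisms with zero center bundle.) -/
def IsBaseSystem {X : Type u} [MetricSpace X] (f : X ≃ₜ X) (lam : ℝ) (Ws Wloc : X → Set X) :
    Prop :=
  PartiallyHyperbolicBase f lam Ws Wloc ∨ HyperbolicSetBase f lam Ws Wloc ∨
    SubshiftBase f lam Ws Wloc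

end

/-!
Consecutive approximations `(A^n_y)⁻¹ ∘ A^n_x` of the holonomy have the form `G ∘ F` and
`G ∘ Δ ∘ F` with `F = A^n_x`, `G = (A^n_y)⁻¹` and `Δ = A_{y'}⁻¹ ∘ A_{x'}`, where `x' = f^n x` and
`y' = f^n y`, so that `Δ` differs from the identity by `O(d(x', y')^β)`. In `C^k` the difference of
`G ∘ Δ ∘ F` and `G ∘ F` has size `d(x', y')^(βγ)`, in `C^(k+γ)` it is merely bounded in terms of `F`
and `G`, and interpolation yields `O(η^(n(k+α+1)) d(x', y')^(β(γ-α)))` in `C^(k+α)`. As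
`d(x', y') ≤ C₀ λ^n`, bunching makes these differences summable. Composition in charts is avoided by
extending functions on the manifold to the ambient Euclidean space of the embedding.
-/

noncomputable section

/-! ## Composition of Taylor series -/

section TaylorComp

variable {𝕜 E F G : Type*} [NontriviallyNormedField 𝕜] [NormedAddCommGroup E] [NormedSpace 𝕜 E]
  [NormedAddCommGroup F] [NormedSpace 𝕜 F] [NormedAddCommGroup G] [NormedSpace 𝕜 G]

/-- The number of terms in the Faà di Bruno formulas of all orders up to `k`. -/
def faaDiBrunoTerms (k : ℕ) : ℝ :=
  ∑ n ∈ Finset.range (k + 1), (Fintype.card (OrderedFinpartition n) : ℝ)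

theorem card_le_faaDiBrunoTerms {n k : ℕ} (hn : n ≤ k) :
    (Fintype.card (OrderedFinpartition n) : ℝ) ≤ faaDiBrunoTerms k :=
  Finset.single_le_sum (f := fun n => (Fintype.card (OrderedFinpartition n) : ℝ))
    (fun _ _ => Nat.cast_nonneg _) (Finset.mem_range.2 (Nat.lt_succ_of_le hn))

theorem faaDiBrunoTerms_nonneg (k : ℕ) : 0 ≤ faaDiBrunoTerms k :=
  Finset.sum_nonneg fun _ _ => Nat.cast_nonneg _

theorem norm_taylorComp_le {n k : ℕ} (hn : n ≤ k) {q : FormalMultilinearSeries 𝕜 F G}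
    {p : FormalMultilinearSeries 𝕜 E F} {U L : ℝ} (hL : 1 ≤ L)
    (hq : ∀ j ≤ k, ‖q j‖ ≤ U) (hp : ∀ j ≤ k, ‖p j‖ ≤ L) :
    ‖q.taylorComp p n‖ ≤ faaDiBrunoTerms k * (U * L ^ k) := by
  have hU : 0 ≤ U := (norm_nonneg _).trans (hq 0 (Nat.zero_le _))
  have hterm (c : OrderedFinpartition n) :
      ‖q.compAlongOrderedFinpartition p c‖ ≤ U * L ^ k := by
    have hc : c.length ≤ k := c.length_le.trans hn
    calc ‖q.compAlongOrderedFinpartition p c‖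
        ≤ ‖q c.length‖ * ∏ i, ‖p (c.partSize i)‖ := c.norm_compAlongOrderedFinpartition_le _ _
      _ ≤ U * ∏ _i : Fin c.length, L := by
          gcongr with i _
          · exact hq _ hc
          · exact hp _ ((c.partSize_le i).trans hn)
      _ ≤ U * L ^ k := by
          rw [Finset.prod_const, Finset.card_univ, Fintype.card_fin]
          gcongr
  calc ‖q.taylorComp p n‖ ≤ Fintype.card (OrderedFinpartition n) * (U * L ^ k) :=
        (norm_sum_le_of_le _ fun c _ => hterm c).trans (by simp)
    _ ≤ _ := by gcongr; exact card_le_faaDiBrunoTerms hn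

theorem norm_compAlongOrderedFinpartition_sub_le {n k : ℕ} (hn : n ≤ k)
    (c : OrderedFinpartition n) {q q' : FormalMultilinearSeries 𝕜 F G}
    {p p' : FormalMultilinearSeries 𝕜 E F} {U L ε δ : ℝ} (hL : 1 ≤ L)
    (hq : ∀ j ≤ k, ‖q j‖ ≤ U) (hqq : ∀ j ≤ k, ‖q j - q' j‖ ≤ δ)
    (hp : ∀ j ≤ k, ‖p j‖ ≤ L) (hp' : ∀ j ≤ k, ‖p' j‖ ≤ L) (hpp : ∀ j ≤ k, ‖p j - p' j‖ ≤ ε) :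
    ‖q.compAlongOrderedFinpartition p c - q'.compAlongOrderedFinpartition p' c‖ ≤
      U * k * L ^ (k - 1) * ε + δ * L ^ k := by
  have hU : 0 ≤ U := (norm_nonneg _).trans (hq 0 (Nat.zero_le _))
  have hδ : 0 ≤ δ := (norm_nonneg _).trans (hqq 0 (Nat.zero_le _))
  have hε : 0 ≤ ε := (norm_nonneg _).trans (hpp 0 (Nat.zero_le _))
  have hc : c.length ≤ k := c.length_le.trans hn
  have hs (i) : c.partSize i ≤ k := (c.partSize_le i).trans hn
  have hpi : ‖fun m => p (c.partSize m)‖ ≤ L :=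
    (pi_norm_le_iff_of_nonneg (by positivity)).2 fun i => hp _ (hs i)
  have hpi' : ‖fun m => p' (c.partSize m)‖ ≤ L :=
    (pi_norm_le_iff_of_nonneg (by positivity)).2 fun i => hp' _ (hs i)
  have hppi : ‖(fun m => p (c.partSize m)) - fun m => p' (c.partSize m)‖ ≤ ε :=
    (pi_norm_le_iff_of_nonneg hε).2 fun i => hpp _ (hs i)
  have hmax : max ‖fun m => p (c.partSize m)‖ ‖fun m => p' (c.partSize m)‖ ^ (c.length - 1) ≤
      L ^ (k - 1) :=
    (pow_le_pow_left₀ (by positivity) (max_le hpi hpi') _).trans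
      (pow_le_pow_right₀ hL (Nat.sub_le_sub_right hc 1))
  have hprod : ∏ i, ‖p' (c.partSize i)‖ ≤ L ^ k :=
    calc ∏ i, ‖p' (c.partSize i)‖ ≤ ∏ _i : Fin c.length, L := by
          gcongr with i _
          exact hp' _ (hs i)
      _ = L ^ c.length := by rw [Finset.prod_const, Finset.card_univ, Fintype.card_fin]
      _ ≤ L ^ k := pow_le_pow_right₀ hL hc
  refine (c.norm_compAlongOrderedFinpartition_sub_compAlongOrderedFinpartition_le
    _ _ _ _).trans ?_
  gcongr
  · exact hq _ hc
  · exact hqq _ hc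

theorem norm_taylorComp_sub_le {n k : ℕ} (hn : n ≤ k) {q q' : FormalMultilinearSeries 𝕜 F G}
    {p p' : FormalMultilinearSeries 𝕜 E F} {U L ε δ : ℝ} (hL : 1 ≤ L)
    (hq : ∀ j ≤ k, ‖q j‖ ≤ U) (hqq : ∀ j ≤ k, ‖q j - q' j‖ ≤ δ)
    (hp : ∀ j ≤ k, ‖p j‖ ≤ L) (hp' : ∀ j ≤ k, ‖p' j‖ ≤ L) (hpp : ∀ j ≤ k, ‖p j - p' j‖ ≤ ε) :
    ‖q.taylorComp p n - q'.taylorComp p' n‖ ≤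
      faaDiBrunoTerms k * (U * k * L ^ (k - 1) * ε + δ * L ^ k) := by
  have hU : 0 ≤ U := (norm_nonneg _).trans (hq 0 (Nat.zero_le _))
  have hδ : 0 ≤ δ := (norm_nonneg _).trans (hqq 0 (Nat.zero_le _))
  have hε : 0 ≤ ε := (norm_nonneg _).trans (hpp 0 (Nat.zero_le _))
  rw [FormalMultilinearSeries.taylorComp, FormalMultilinearSeries.taylorComp,
    ← Finset.sum_sub_distrib]
  calc _ ≤ Fintype.card (OrderedFinpartition n) * (U * k * L ^ (k - 1) * ε + δ * L ^ k) :=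
        (norm_sum_le_of_le _ fun c _ =>
          norm_compAlongOrderedFinpartition_sub_le hn c hL hq hqq hp hp' hpp).trans
            (by simp [mul_add])
    _ ≤ _ := by gcongr; exact card_le_faaDiBrunoTerms hn

end TaylorComp

/-! ## Functions with bounded jets -/

theorem le_mul_rpow_of_le_of_le_mul {α a s t : ℝ} (hα : 0 ≤ α) (hα' : α ≤ 1) (ha : 0 ≤ a)
    (ht : 0 ≤ t) (hs : s ≤ a) (hst : s ≤ a * t) : s ≤ a * t ^ α := by
  rcases le_total t 1 with h | h
  · exact hst.trans (by gcongr; exact Real.self_le_rpow_of_le_one ht h hα')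
  · exact hs.trans (le_mul_of_one_le_right ha (Real.one_le_rpow h hα))

theorem norm_iteratedFDeriv_sub_le_of_convex {E F : Type*} [NormedAddCommGroup E]
    [NormedSpace ℝ E] [NormedAddCommGroup F] [NormedSpace ℝ F] {f : E → F} {S : Set E} {B : ℝ}
    {j : ℕ} (hS : Convex ℝ S) (hf : ∀ x ∈ S, ContDiffAt ℝ (j + 1) f x)
    (hB : ∀ x ∈ S, ‖iteratedFDeriv ℝ (j + 1) f x‖ ≤ B) {x y : E} (hx : x ∈ S) (hy : y ∈ S) :
    ‖iteratedFDeriv ℝ j f x - iteratedFDeriv ℝ j f y‖ ≤ B * ‖x - y‖ :=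
  hS.norm_image_sub_le_of_norm_fderiv_le (𝕜 := ℝ)
    (fun z hz => (hf z hz).differentiableAt_iteratedFDeriv (mod_cast Nat.lt_succ_self j))
    (fun z hz => by rw [norm_fderiv_iteratedFDeriv]; exact hB z hz) hy hx

/-- The `C^{k+α}` norm of `f` on `S` is at most `B`: `f` is `C^k` at the points of `S`, its
derivatives of order at most `k` are bounded by `B` on `S`, and the one of order `k` is `α`-Hölder
with constant `B`. Nonnegativity of `B` is only a restriction if `S` is empty. -/
structure JetBound {E F : Type*} [NormedAddCommGroup E] [NormedSpace ℝ E] [NormedAddCommGroup F]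
    [NormedSpace ℝ F] (k : ℕ) (α : ℝ) (f : E → F) (S : Set E) (B : ℝ) : Prop where
  nonneg : 0 ≤ B
  contDiffAt : ∀ x ∈ S, ContDiffAt ℝ k f x
  norm_le : ∀ j ≤ k, ∀ x ∈ S, ‖iteratedFDeriv ℝ j f x‖ ≤ B
  holder : ∀ x ∈ S, ∀ y ∈ S,
    ‖iteratedFDeriv ℝ k f x - iteratedFDeriv ℝ k f y‖ ≤ B * ‖x - y‖ ^ α

namespace JetBound

variable {E F G : Type*} [NormedAddCommGroup E] [NormedSpace ℝ E] [NormedAddCommGroup F]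
  [NormedSpace ℝ F] [NormedAddCommGroup G] [NormedSpace ℝ G]
  {k : ℕ} {α γ : ℝ} {f f' : E → F} {g : F → G} {S : Set E} {T : Set F} {B B' L δ : ℝ}

theorem mono (h : JetBound k α f S B) (hB : B ≤ B') : JetBound k α f S B' where
  nonneg := h.nonneg.trans hB
  contDiffAt := h.contDiffAt
  norm_le j hj x hx := (h.norm_le j hj x hx).trans hB
  holder x hx y hy := (h.holder x hx y hy).trans (by gcongr)

theorem mono_set (h : JetBound k α f S B) {S' : Set E} (hS : S' ⊆ S) : JetBound k α f S' B where
  nonneg := h.nonneg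
  contDiffAt x hx := h.contDiffAt x (hS hx)
  norm_le j hj x hx := h.norm_le j hj x (hS hx)
  holder x hx y hy := h.holder x (hS hx) y (hS hy)

theorem norm_apply_le (h : JetBound k α f S B) {x : E} (hx : x ∈ S) : ‖f x‖ ≤ B := by
  simpa using h.norm_le 0 (Nat.zero_le _) x hx

theorem zero : JetBound k α (fun _ : E => (0 : F)) S 0 where
  nonneg := le_rfl
  contDiffAt _ _ := contDiffAt_const
  norm_le j _ x _ := by simp
  holder x _ y _ := by simp

theorem add (h : JetBound k α f S B) (h' : JetBound k α f' S B') :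
    JetBound k α (fun x => f x + f' x) S (B + B') where
  nonneg := add_nonneg h.nonneg h'.nonneg
  contDiffAt x hx := (h.contDiffAt x hx).add (h'.contDiffAt x hx)
  norm_le j hj x hx := by
    rw [fun_iteratedFDeriv_add_apply ((h.contDiffAt x hx).of_le (mod_cast hj))
      ((h'.contDiffAt x hx).of_le (mod_cast hj))]
    exact norm_add_le_of_le (h.norm_le j hj x hx) (h'.norm_le j hj x hx)
  holder x hx y hy := by
    rw [fun_iteratedFDeriv_add_apply (h.contDiffAt x hx) (h'.contDiffAt x hx),
      fun_iteratedFDeriv_add_apply (h.contDiffAt y hy) (h'.contDiffAt y hy), add_sub_add_comm,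
      add_mul]
    exact norm_add_le_of_le (h.holder x hx y hy) (h'.holder x hx y hy)

theorem neg (h : JetBound k α f S B) : JetBound k α (-f) S B where
  nonneg := h.nonneg
  contDiffAt x hx := (h.contDiffAt x hx).neg
  norm_le j hj x hx := by
    rw [iteratedFDeriv_neg_apply, norm_neg]
    exact h.norm_le j hj x hx
  holder x hx y hy := by
    rw [iteratedFDeriv_neg_apply, iteratedFDeriv_neg_apply, neg_sub_neg, norm_sub_rev]
    exact h.holder x hx y hy

theorem sub (h : JetBound k α f S B) (h' : JetBound k α f' S B') :
    JetBound k α (fun x => f x - f' x) S (B + B') := by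
  simpa only [sub_eq_add_neg, Pi.neg_apply] using h.add h'.neg

theorem sum {ι : Type*} (s : Finset ι) {f : ι → E → F} {B : ι → ℝ}
    (h : ∀ i ∈ s, JetBound k α (f i) S (B i)) :
    JetBound k α (fun x => ∑ i ∈ s, f i x) S (∑ i ∈ s, B i) := by
  classical
  induction s using Finset.induction_on with
  | empty => simpa using zero
  | insert i s hi ih =>
    simp only [Finset.sum_insert hi]
    exact (h i (Finset.mem_insert_self i s)).add
      (ih fun j hj => h j (Finset.mem_insert_of_mem hj))

theorem norm_sub_le_of_lt (h : JetBound k α f S B) (hS : Convex ℝ S) {j : ℕ} (hj : j < k)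
    {x y : E} (hx : x ∈ S) (hy : y ∈ S) :
    ‖iteratedFDeriv ℝ j f x - iteratedFDeriv ℝ j f y‖ ≤ B * ‖x - y‖ :=
  norm_iteratedFDeriv_sub_le_of_convex hS
    (fun z hz => (h.contDiffAt z hz).of_le (mod_cast hj)) (h.norm_le (j + 1) hj) hx hy

theorem lipschitz (h : JetBound k α f S B) (hS : Convex ℝ S) (hk : 1 ≤ k)
    {x y : E} (hx : x ∈ S) (hy : y ∈ S) : ‖f x - f y‖ ≤ B * ‖x - y‖ := by
  have := h.norm_sub_le_of_lt hS hk hx hy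
  rwa [iteratedFDeriv_zero_eq_comp, Function.comp_apply, Function.comp_apply, ← map_sub,
    LinearIsometryEquiv.norm_map] at this

theorem norm_sub_le (h : JetBound k α f S B) (hS : Convex ℝ S) (hα : 0 ≤ α) (hα' : α ≤ 1) {j : ℕ}
    (hj : j ≤ k) {x y : E} (hx : x ∈ S) (hy : y ∈ S) :
    ‖iteratedFDeriv ℝ j f x - iteratedFDeriv ℝ j f y‖ ≤ 2 * B * ‖x - y‖ ^ α := by
  have hB : B ≤ 2 * B := le_mul_of_one_le_left h.nonneg one_le_two
  rcases hj.lt_or_eq with hj' | rfl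
  · refine le_mul_rpow_of_le_of_le_mul hα hα' (h.nonneg.trans hB) (norm_nonneg _) ?_ ?_
    · rw [two_mul]
      exact norm_sub_le_of_le (h.norm_le j hj x hx) (h.norm_le j hj y hy)
    · exact (h.norm_sub_le_of_lt hS hj' hx hy).trans (by gcongr)
  · exact (h.holder x hx y hy).trans (by gcongr)

theorem of_norm_le (hB : 0 ≤ B) (hf : ∀ x ∈ S, ContDiffAt ℝ k f x)
    (h : ∀ j ≤ k, ∀ x ∈ S, ‖iteratedFDeriv ℝ j f x‖ ≤ B) : JetBound k 0 f S (2 * B) where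
  nonneg := by positivity
  contDiffAt := hf
  norm_le j hj x hx := (h j hj x hx).trans (le_mul_of_one_le_left hB one_le_two)
  holder x hx y hy := by
    rw [Real.rpow_zero, mul_one, two_mul]
    exact norm_sub_le_of_le (h k le_rfl x hx) (h k le_rfl y hy)

theorem of_norm_le_succ (hB : 0 ≤ B) (hS : Convex ℝ S) (hf : ∀ x ∈ S, ContDiffAt ℝ (k + 1) f x)
    (h : ∀ j ≤ k + 1, ∀ x ∈ S, ‖iteratedFDeriv ℝ j f x‖ ≤ B) (hα : 0 ≤ α) (hα' : α ≤ 1) :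
    JetBound k α f S (2 * B) := by
  have hC : JetBound (k + 1) 0 f S (2 * B) := of_norm_le hB (mod_cast hf) h
  refine ⟨hC.nonneg, fun x hx => (hf x hx).of_le (mod_cast k.le_succ),
    fun j hj => hC.norm_le j (hj.trans k.le_succ), fun x hx y hy => ?_⟩
  refine le_mul_rpow_of_le_of_le_mul hα hα' hC.nonneg (norm_nonneg _) ?_
    (hC.norm_sub_le_of_lt hS k.lt_succ_self hx hy)
  rw [two_mul]
  exact norm_sub_le_of_le (h k k.le_succ x hx) (h k k.le_succ y hy)

theorem exists_of_isCompact (hS : IsCompact S) (hc : Convex ℝ S)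
    (hf : ∀ x ∈ S, ContDiffAt ℝ (k + 1) f x) (hα : 0 ≤ α) (hα' : α ≤ 1) :
    ∃ B, JetBound k α f S B := by
  have hcont (j : Fin (k + 2)) : ContinuousOn (iteratedFDeriv ℝ j f) S := fun x hx =>
    ((hf x hx).continuousAt_iteratedFDeriv
      (mod_cast Nat.lt_succ_iff.1 j.2)).continuousWithinAt
  choose b hb using fun j => hS.exists_bound_of_continuousOn (hcont j)
  have hbB (j : Fin (k + 2)) : b j ≤ ∑ i, |b i| :=
    (le_abs_self _).trans (Finset.single_le_sum (fun i _ => abs_nonneg (b i)) (Finset.mem_univ j))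
  exact ⟨_, of_norm_le_succ (Finset.sum_nonneg fun i _ => abs_nonneg (b i)) hc hf
    (fun j hj x hx => (hb ⟨j, Nat.lt_succ_of_le hj⟩ x hx).trans (hbB _)) hα hα'⟩

theorem comp (hg : JetBound k α g T B) (hf : JetBound k α f S L) (hT : Convex ℝ T)
    (hS : Convex ℝ S) (hfT : MapsTo f S T) (hk : 1 ≤ k) (hα : 0 ≤ α) (hα' : α ≤ 1) (hL : 1 ≤ L) :
    JetBound k α (g ∘ f) S (faaDiBrunoTerms k * (2 * k + 2) * (B * L ^ (k + α))) := by
  have hB := hg.nonneg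
  have hN := faaDiBrunoTerms_nonneg k
  have hL0 : 0 < L := by positivity
  refine ⟨by positivity, fun x hx => (hg.contDiffAt _ (hfT hx)).comp x (hf.contDiffAt x hx),
    fun j hj x hx => ?_, fun x hx y hy => ?_⟩
  · rw [iteratedFDeriv_comp (hg.contDiffAt _ (hfT hx)) (hf.contDiffAt x hx) (mod_cast hj)]
    calc _ ≤ faaDiBrunoTerms k * (B * L ^ k) :=
          norm_taylorComp_le hj hL (fun i hi => hg.norm_le i hi _ (hfT hx))
            (fun i hi => hf.norm_le i hi x hx)
      _ ≤ faaDiBrunoTerms k * 1 * (B * L ^ (k + α)) := by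
          rw [mul_one, ← Real.rpow_natCast]
          gcongr
          linarith
      _ ≤ _ := by gcongr; linarith [k.cast_nonneg (α := ℝ)]
  · rw [iteratedFDeriv_comp (hg.contDiffAt _ (hfT hx)) (hf.contDiffAt x hx) le_rfl,
      iteratedFDeriv_comp (hg.contDiffAt _ (hfT hy)) (hf.contDiffAt y hy) le_rfl]
    have hfx : ‖f x - f y‖ ^ α ≤ L ^ α * ‖x - y‖ ^ α := by
      rw [← Real.mul_rpow hL0.le (norm_nonneg _)]
      gcongr
      exact hf.lipschitz hS hk hx hy
    calc _ ≤ faaDiBrunoTerms k * (B * k * L ^ (k - 1) * (2 * L * ‖x - y‖ ^ α) +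
            2 * B * (L ^ α * ‖x - y‖ ^ α) * L ^ k) :=
          norm_taylorComp_sub_le le_rfl hL (fun i hi => hg.norm_le i hi _ (hfT hx))
            (fun i hi => (hg.norm_sub_le hT hα hα' hi (hfT hx) (hfT hy)).trans (by gcongr))
            (fun i hi => hf.norm_le i hi x hx) (fun i hi => hf.norm_le i hi y hy)
            (fun i hi => hf.norm_sub_le hS hα hα' hi hx hy)
      _ = faaDiBrunoTerms k * (2 * (B * (k * L ^ k + L ^ (k + α)))) * ‖x - y‖ ^ α := by
          rw [← pow_sub_one_mul (by lia : k ≠ 0) L, Real.rpow_add hL0, Real.rpow_natCast,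
            ← pow_sub_one_mul (by lia : k ≠ 0) L]
          ring
      _ ≤ faaDiBrunoTerms k * (2 * (B * (k * L ^ (k + α) + L ^ (k + α)))) * ‖x - y‖ ^ α := by
          rw [← Real.rpow_natCast L k]
          gcongr
          linarith
      _ = _ := by ring

theorem interpolate {a b : ℝ} (ha : JetBound k 0 f S a) (hb : JetBound k γ f S b) (hγ : 0 < γ)
    (hα : 0 ≤ α) (hαγ : α ≤ γ) : JetBound k α f S (a ^ (1 - α / γ) * b ^ (α / γ)) := by
  have ha0 := ha.nonneg
  have hb0 := hb.nonneg
  have hs : 0 ≤ α / γ := by positivity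
  have hs' : 0 ≤ 1 - α / γ := by rw [sub_nonneg, div_le_one hγ]; exact hαγ
  have hsplit {t a b : ℝ} (ht : 0 ≤ t) (hta : t ≤ a) (htb : t ≤ b) :
      t ≤ a ^ (1 - α / γ) * b ^ (α / γ) := by
    calc t = t ^ (1 - α / γ) * t ^ (α / γ) := by
          rw [← Real.rpow_add_of_nonneg ht hs' hs, sub_add_cancel, Real.rpow_one]
      _ ≤ _ := by have := ht.trans hta; gcongr
  refine ⟨by positivity, ha.contDiffAt, fun j hj x hx =>
    hsplit (norm_nonneg _) (ha.norm_le j hj x hx) (hb.norm_le j hj x hx), fun x hx y hy => ?_⟩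
  calc _ ≤ a ^ (1 - α / γ) * (b * ‖x - y‖ ^ γ) ^ (α / γ) :=
        hsplit (norm_nonneg _) (by simpa using ha.holder x hx y hy) (hb.holder x hx y hy)
    _ = _ := by
        rw [Real.mul_rpow hb0 (by positivity), ← Real.rpow_mul (norm_nonneg _),
          mul_div_cancel₀ _ hγ.ne', mul_assoc]

theorem comp_sub_comp_zero (hg : JetBound k γ g T B) (hf : JetBound k γ f S L)
    (hf' : JetBound k γ f' S L) (hff : JetBound k 0 (fun x => f x - f' x) S δ) (hT : Convex ℝ T)
    (hfT : MapsTo f S T) (hfT' : MapsTo f' S T) (hk : 1 ≤ k) (hγ : 0 ≤ γ) (hγ' : γ ≤ 1)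
    (hL : 1 ≤ L) :
    JetBound k 0 (fun x => g (f x) - g (f' x)) S
      (2 * (faaDiBrunoTerms k * (2 * k + 2) * (B * L ^ k * δ ^ γ))) := by
  have hB := hg.nonneg
  have hδ := hff.nonneg
  have hN := faaDiBrunoTerms_nonneg k
  have hc (x) (hx : x ∈ S) : ContDiffAt ℝ k (g ∘ f) x :=
    (hg.contDiffAt _ (hfT hx)).comp x (hf.contDiffAt x hx)
  have hc' (x) (hx : x ∈ S) : ContDiffAt ℝ k (g ∘ f') x :=
    (hg.contDiffAt _ (hfT' hx)).comp x (hf'.contDiffAt x hx)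
  refine of_norm_le (by positivity) (fun x hx => (hc x hx).sub (hc' x hx)) fun j hj x hx => ?_
  change ‖iteratedFDeriv ℝ j (fun x => (g ∘ f) x - (g ∘ f') x) x‖ ≤ _
  rw [fun_iteratedFDeriv_sub_apply ((hc x hx).of_le (mod_cast hj))
    ((hc' x hx).of_le (mod_cast hj)),
    iteratedFDeriv_comp (hg.contDiffAt _ (hfT hx)) (hf.contDiffAt x hx) (mod_cast hj),
    iteratedFDeriv_comp (hg.contDiffAt _ (hfT' hx)) (hf'.contDiffAt x hx) (mod_cast hj)]
  have hg_sub (i) (hi : i ≤ k) :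
      ‖iteratedFDeriv ℝ i g (f x) - iteratedFDeriv ℝ i g (f' x)‖ ≤ 2 * B * δ ^ γ :=
    (hg.norm_sub_le hT hγ hγ' hi (hfT hx) (hfT' hx)).trans
      (by gcongr; exact hff.norm_apply_le hx)
  have hf_sub (i) (hi : i ≤ k) :
      ‖iteratedFDeriv ℝ i f x - iteratedFDeriv ℝ i f' x‖ ≤ 2 * L * δ ^ γ := by
    refine le_mul_rpow_of_le_of_le_mul hγ hγ' (by positivity) hδ ?_ ?_
    · rw [two_mul]
      exact norm_sub_le_of_le (hf.norm_le i hi x hx) (hf'.norm_le i hi x hx)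
    · rw [← fun_iteratedFDeriv_sub_apply ((hf.contDiffAt x hx).of_le (mod_cast hi))
        ((hf'.contDiffAt x hx).of_le (mod_cast hi))]
      exact (hff.norm_le i hi x hx).trans (le_mul_of_one_le_left hδ (by linarith))
  calc _ ≤ faaDiBrunoTerms k * (B * k * L ^ (k - 1) * (2 * L * δ ^ γ) + 2 * B * δ ^ γ * L ^ k) :=
        norm_taylorComp_sub_le hj hL (fun i hi => hg.norm_le i hi _ (hfT hx)) hg_sub
          (fun i hi => hf.norm_le i hi x hx) (fun i hi => hf'.norm_le i hi x hx) hf_sub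
    _ = _ := by
        rw [← pow_sub_one_mul (by lia : k ≠ 0) L]
        ring

/-- Interpolation trades part of the Hölder regularity of `g` for smallness of the difference. -/
theorem comp_sub_comp (hg : JetBound k γ g T B) (hf : JetBound k γ f S L)
    (hf' : JetBound k γ f' S L) (hff : JetBound k 0 (fun x => f x - f' x) S δ) (hT : Convex ℝ T)
    (hS : Convex ℝ S) (hfT : MapsTo f S T) (hfT' : MapsTo f' S T) (hk : 1 ≤ k) (hα : 0 ≤ α)
    (hαγ : α ≤ γ) (hγ : 0 < γ) (hγ' : γ ≤ 1) (hL : 1 ≤ L) :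
    JetBound k α (fun x => g (f x) - g (f' x)) S
      (2 * (faaDiBrunoTerms k * (2 * k + 2) * (B * L ^ (k + γ))) * δ ^ (γ - α)) := by
  have hB := hg.nonneg
  have hδ := hff.nonneg
  have hN := faaDiBrunoTerms_nonneg k
  have hsmall := hg.comp_sub_comp_zero hf hf' hff hT hfT hfT' hk hγ.le hγ' hL
  have hlarge := (hg.comp hf hT hS hfT hk hγ.le hγ' hL).sub
    (hg.comp hf' hT hS hfT' hk hγ.le hγ' hL)
  set P := 2 * (faaDiBrunoTerms k * (2 * k + 2) * (B * L ^ (k + γ)))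
  have hP : 0 ≤ P := by positivity
  have hsmall' : JetBound k 0 (fun x => g (f x) - g (f' x)) S (P * δ ^ γ) := by
    refine hsmall.mono ?_
    calc _ = 2 * (faaDiBrunoTerms k * (2 * k + 2) * (B * L ^ (k : ℝ))) * δ ^ γ := by
          rw [Real.rpow_natCast]; ring
      _ ≤ P * δ ^ γ := by simp only [P]; gcongr; linarith
  refine (hsmall'.interpolate (hlarge.mono (two_mul _).ge) hγ hα hαγ).mono (le_of_eq ?_)
  calc (P * δ ^ γ) ^ (1 - α / γ) * P ^ (α / γ)
      = P ^ (1 - α / γ + α / γ) * δ ^ (γ * (1 - α / γ)) := by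
        rw [Real.mul_rpow hP (by positivity), ← Real.rpow_mul hδ, Real.rpow_add_of_nonneg hP]
        · ring
        · rw [sub_nonneg, div_le_one hγ]; exact hαγ
        · positivity
    _ = P * δ ^ (γ - α) := by
        rw [sub_add_cancel, Real.rpow_one, mul_sub, mul_one, mul_div_cancel₀ _ hγ.ne']

end JetBound

section Leibniz

variable {𝕜 𝕜' E F : Type*} [NontriviallyNormedField 𝕜] [NormedField 𝕜'] [NormedAlgebra 𝕜 𝕜']
  [NormedAddCommGroup E] [NormedSpace 𝕜 E] [NormedAddCommGroup F] [NormedSpace 𝕜 F]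
  [NormedSpace 𝕜' F] [IsScalarTower 𝕜 𝕜' F] {χ : E → 𝕜'} {f : E → F} {k : ℕ} {x y : E}

theorem norm_iteratedFDeriv_smul_le_of_contDiffAt (hχ : ContDiffAt 𝕜 k χ x)
    (hf : ContDiffAt 𝕜 k f x) {n : ℕ} (hn : n ≤ k) :
    ‖iteratedFDeriv 𝕜 n (fun y => χ y • f y) x‖ ≤ ∑ i ∈ Finset.range (n + 1),
      (n.choose i : ℝ) * ‖iteratedFDeriv 𝕜 i χ x‖ * ‖iteratedFDeriv 𝕜 (n - i) f x‖ := by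
  obtain ⟨V, hV, hVo, hxV⟩ := eventually_nhds_iff.1
    ((hχ.eventually (by simp)).and (hf.eventually (by simp)))
  simpa only [iteratedFDerivWithin_of_isOpen _ hVo hxV] using
    norm_iteratedFDerivWithin_smul_le (fun y hy => (hV y hy).1.contDiffWithinAt)
      (fun y hy => (hV y hy).2.contDiffWithinAt) hVo.uniqueDiffOn hxV (mod_cast hn : (n : ℕ∞ω) ≤ k)

theorem norm_iteratedFDeriv_smul_le_of_norm_le {a b : ℝ} (hχ : ContDiffAt 𝕜 k χ x)
    (hf : ContDiffAt 𝕜 k f x) (ha : ∀ j ≤ k, ‖iteratedFDeriv 𝕜 j χ x‖ ≤ a)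
    (hb : ∀ j ≤ k, ‖iteratedFDeriv 𝕜 j f x‖ ≤ b) {n : ℕ} (hn : n ≤ k) :
    ‖iteratedFDeriv 𝕜 n (fun y => χ y • f y) x‖ ≤ 2 ^ n * (a * b) := by
  have ha0 : 0 ≤ a := (norm_nonneg _).trans (ha 0 (Nat.zero_le _))
  calc _ ≤ ∑ i ∈ Finset.range (n + 1),
        (n.choose i : ℝ) * ‖iteratedFDeriv 𝕜 i χ x‖ * ‖iteratedFDeriv 𝕜 (n - i) f x‖ :=
        norm_iteratedFDeriv_smul_le_of_contDiffAt hχ hf hn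
    _ ≤ ∑ i ∈ Finset.range (n + 1), (n.choose i : ℝ) * a * b := by
        gcongr with i hi
        · exact ha _ ((Nat.lt_succ_iff.1 (Finset.mem_range.1 hi)).trans hn)
        · exact hb _ ((Nat.sub_le _ _).trans hn)
    _ = 2 ^ n * (a * b) := by
        simp_rw [mul_assoc]
        rw [← Finset.sum_mul, ← Nat.cast_sum, Nat.sum_range_choose]
        push_cast
        rfl

theorem contDiffAt_comp_add_sub (hf : ContDiffAt 𝕜 k f y) :
    ContDiffAt 𝕜 k (fun z => f (z + (y - x))) x :=
  ContDiffAt.comp (g := f) x (by rwa [add_sub_cancel]) (by fun_prop)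

theorem iteratedFDeriv_comp_add_sub (f : E → F) (j : ℕ) :
    iteratedFDeriv 𝕜 j (fun z => f (z + (y - x))) x = iteratedFDeriv 𝕜 j f y := by
  rw [iteratedFDeriv_comp_add_right, add_sub_cancel]

/-- Translating by `y - x` turns a difference of derivatives at two points into derivatives at one
point, to which the Leibniz rule applies. -/
theorem iteratedFDeriv_smul_sub_iteratedFDeriv_smul (hχ : ContDiffAt 𝕜 k χ x)
    (hχ' : ContDiffAt 𝕜 k χ y) (hf : ContDiffAt 𝕜 k f x) (hf' : ContDiffAt 𝕜 k f y) :
    iteratedFDeriv 𝕜 k (fun z => χ z • f z) y - iteratedFDeriv 𝕜 k (fun z => χ z • f z) x =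
      iteratedFDeriv 𝕜 k (fun z => (χ (z + (y - x)) - χ z) • f (z + (y - x))) x +
        iteratedFDeriv 𝕜 k (fun z => χ z • (f (z + (y - x)) - f z)) x := by
  have tχ : ContDiffAt 𝕜 k (fun z => χ (z + (y - x))) x := contDiffAt_comp_add_sub hχ'
  have tf : ContDiffAt 𝕜 k (fun z => f (z + (y - x))) x := contDiffAt_comp_add_sub hf'
  have tχf : ContDiffAt 𝕜 k (fun z => χ (z + (y - x)) • f (z + (y - x))) x := tχ.smul tf
  have hχf : ContDiffAt 𝕜 k (fun z => χ z • f z) x := hχ.smul hf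
  have hleft : ContDiffAt 𝕜 k (fun z => (χ (z + (y - x)) - χ z) • f (z + (y - x))) x :=
    (tχ.sub hχ).smul tf
  have hright : ContDiffAt 𝕜 k (fun z => χ z • (f (z + (y - x)) - f z)) x := hχ.smul (tf.sub hf)
  rw [← iteratedFDeriv_comp_add_sub (x := x) (y := y) (fun z => χ z • f z),
    ← fun_iteratedFDeriv_sub_apply tχf hχf, ← fun_iteratedFDeriv_add_apply hleft hright]
  congr 1
  ext z
  rw [sub_smul, smul_sub]
  abel

end Leibniz

namespace JetBound

variable {E F : Type*} [NormedAddCommGroup E] [NormedSpace ℝ E] [NormedAddCommGroup F]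
  [NormedSpace ℝ F] {k : ℕ} {α : ℝ} {f : E → F} {S : Set E} {B : ℝ}

theorem norm_iteratedFDeriv_comp_add_sub_sub_le (hf : JetBound k α f S B) (hS : Convex ℝ S)
    (hα : 0 ≤ α) (hα' : α ≤ 1) {x y : E} (hx : x ∈ S) (hy : y ∈ S) {j : ℕ} (hj : j ≤ k) :
    ‖iteratedFDeriv ℝ j (fun z => f (z + (y - x)) - f z) x‖ ≤ 2 * B * ‖x - y‖ ^ α := by
  rw [fun_iteratedFDeriv_sub_apply
    (contDiffAt_comp_add_sub ((hf.contDiffAt y hy).of_le (mod_cast hj)))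
    ((hf.contDiffAt x hx).of_le (mod_cast hj)), iteratedFDeriv_comp_add_sub, norm_sub_rev]
  exact hf.norm_sub_le hS hα hα' hj hx hy

theorem smul {χ : E → ℝ} {A : ℝ} (hχ : JetBound k α χ S A) (hf : JetBound k α f S B)
    (hS : Convex ℝ S) (hα : 0 ≤ α) (hα' : α ≤ 1) :
    JetBound k α (fun x => χ x • f x) S (2 ^ (k + 2) * (A * B)) := by
  have hA := hχ.nonneg
  have hB := hf.nonneg
  refine ⟨by positivity, fun x hx => (hχ.contDiffAt x hx).smul (hf.contDiffAt x hx),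
    fun j hj x hx => ?_, fun x hx y hy => ?_⟩
  · refine (norm_iteratedFDeriv_smul_le_of_norm_le (hχ.contDiffAt x hx) (hf.contDiffAt x hx)
      (fun i hi => hχ.norm_le i hi x hx) (fun i hi => hf.norm_le i hi x hx) hj).trans ?_
    gcongr
    · exact one_le_two
    · exact Nat.le_add_right_of_le hj
  · have dχ := hχ.contDiffAt x hx
    have df := hf.contDiffAt x hx
    have tχ : ContDiffAt ℝ k (fun z => χ (z + (y - x))) x :=
      contDiffAt_comp_add_sub (hχ.contDiffAt y hy)
    have tf : ContDiffAt ℝ k (fun z => f (z + (y - x))) x :=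
      contDiffAt_comp_add_sub (hf.contDiffAt y hy)
    have hleft := norm_iteratedFDeriv_smul_le_of_norm_le (tχ.sub dχ) tf
      (fun j hj => hχ.norm_iteratedFDeriv_comp_add_sub_sub_le hS hα hα' hx hy hj)
      (fun j hj => (iteratedFDeriv_comp_add_sub (𝕜 := ℝ) f j).symm ▸ hf.norm_le j hj y hy) le_rfl
    have hright := norm_iteratedFDeriv_smul_le_of_norm_le dχ (tf.sub df)
      (fun j hj => hχ.norm_le j hj x hx)
      (fun j hj => hf.norm_iteratedFDeriv_comp_add_sub_sub_le hS hα hα' hx hy hj) le_rfl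
    rw [norm_sub_rev, iteratedFDeriv_smul_sub_iteratedFDeriv_smul dχ (hχ.contDiffAt y hy) df
      (hf.contDiffAt y hy)]
    refine (norm_add_le_of_le hleft hright).trans (le_of_eq ?_)
    ring

theorem tsum [CompleteSpace F] {f : ℕ → E → F} {b : ℕ → ℝ}
    (h : ∀ n, JetBound k α (f n) univ (b n)) (hb : Summable b) :
    JetBound k α (fun x => ∑' n, f n x) univ (∑' n, b n) := by
  have hd (n) : ContDiff ℝ ((k : ℕ∞) : ℕ∞ω) (f n) :=
    contDiff_iff_contDiffAt.2 fun x => (h n).contDiffAt x (mem_univ x)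
  have hle (j n : ℕ) (x : E) (hj : (j : ℕ∞) ≤ (k : ℕ∞)) : ‖iteratedFDeriv ℝ j (f n) x‖ ≤ b n :=
    (h n).norm_le j (mod_cast hj) x (mem_univ x)
  have htsum {j : ℕ} (hj : j ≤ k) (x : E) : iteratedFDeriv ℝ j (fun x => ∑' n, f n x) x =
      ∑' n, iteratedFDeriv ℝ j (f n) x :=
    iteratedFDeriv_tsum_apply (v := fun _ => b) hd (fun _ _ => hb) hle (mod_cast hj) x
  have hs (x) : Summable fun n => iteratedFDeriv ℝ k (f n) x :=
    .of_norm_bounded hb fun n => hle k n x le_rfl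
  refine ⟨tsum_nonneg fun n => (h n).nonneg, fun x _ => (contDiff_tsum (v := fun _ => b) hd
    (fun _ _ => hb) hle).contDiffAt, fun j hj x _ => ?_, fun x _ y _ => ?_⟩
  · rw [htsum hj]
    exact tsum_of_norm_bounded hb.hasSum fun n => hle j n x (mod_cast hj)
  · rw [htsum le_rfl, htsum le_rfl, ← (hs x).tsum_sub (hs y)]
    exact tsum_of_norm_bounded (hb.hasSum.mul_right _) fun n =>
      (h n).holder x (mem_univ x) y (mem_univ y)

theorem univ_of_forall_notMem {K : Set E} {δ : ℝ} (h : JetBound k α f S B) (hK : IsClosed K)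
    (hKS : K ⊆ S) (hf : ∀ x ∉ K, f x = 0) (hδ : 0 < δ) (hδS : Metric.thickening δ K ⊆ S)
    (hα : 0 ≤ α) : JetBound k α f univ (max 1 (δ ^ α)⁻¹ * B) := by
  have hB := h.nonneg
  have hBC : B ≤ max 1 (δ ^ α)⁻¹ * B := le_mul_of_one_le_left hB (le_max_left _ _)
  have hev (x) (hx : x ∉ K) : f =ᶠ[𝓝 x] fun _ => 0 := by
    filter_upwards [hK.isOpen_compl.mem_nhds hx] with y hy using hf y hy
  have hzero (x) (hx : x ∉ K) (j : ℕ) : iteratedFDeriv ℝ j f x = 0 := by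
    rw [((hev x hx).iteratedFDeriv ℝ j).eq_of_nhds]
    simp
  have hfar (x) (hx : x ∈ K) (y) (hy : y ∉ S) :
      ‖iteratedFDeriv ℝ k f x‖ ≤ max 1 (δ ^ α)⁻¹ * B * ‖x - y‖ ^ α := by
    have hd : δ ≤ ‖x - y‖ := by
      by_contra! hlt
      exact hy (hδS (Metric.mem_thickening_iff.2 ⟨x, hx, by rwa [dist_comm, dist_eq_norm]⟩))
    calc _ ≤ B := h.norm_le k le_rfl x (hKS hx)
      _ = (δ ^ α)⁻¹ * B * δ ^ α := by field_simp
      _ ≤ _ := by gcongr; exact le_max_right _ _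
  refine ⟨by positivity, fun x _ => ?_, fun j hj x _ => ?_, fun x _ y _ => ?_⟩
  · by_cases hx : x ∈ K
    · exact h.contDiffAt x (hKS hx)
    · exact contDiffAt_const.congr_of_eventuallyEq (hev x hx)
  · by_cases hx : x ∈ K
    · exact (h.norm_le j hj x (hKS hx)).trans hBC
    · rw [hzero x hx, norm_zero]
      positivity
  · by_cases hxy : x ∈ S ∧ y ∈ S
    · exact (h.holder x hxy.1 y hxy.2).trans (by gcongr)
    · by_cases hx : x ∈ K
      · have hy : y ∉ S := fun hy => hxy ⟨hKS hx, hy⟩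
        rw [hzero y fun hyK => hy (hKS hyK), sub_zero]
        exact hfar x hx y hy
      · by_cases hy : y ∈ K
        · rw [hzero x hx, zero_sub, norm_neg, norm_sub_rev]
          exact hfar y hy x fun hx => hxy ⟨hx, hKS hy⟩
        · rw [hzero x hx, hzero y hy, sub_zero, norm_zero]
          positivity

theorem exists_extend_zero (F : Type*) [NormedAddCommGroup F] [NormedSpace ℝ F] {K : Set E}
    (hK : IsCompact K) (hS : IsOpen S) (hKS : K ⊆ S) (hα : 0 ≤ α) :
    ∃ C : ℝ, ∀ (f : E → F) (B : ℝ), (∀ x ∉ K, f x = 0) → JetBound k α f S B →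
      JetBound k α f univ (C * B) := by
  obtain ⟨δ, hδ, hδS⟩ := hK.exists_thickening_subset_open hS hKS
  exact ⟨_, fun f B hf h => h.univ_of_forall_notMem hK.isClosed hKS hf hδ hδS hα⟩

end JetBound

/-! ## Extension of functions from the manifold to the ambient space -/

theorem exists_contDiffAt_eventually_leftInverse {E F : Type*} [NormedAddCommGroup E]
    [NormedSpace ℝ E] [FiniteDimensional ℝ E] [NormedAddCommGroup F] [NormedSpace ℝ F]
    [FiniteDimensional ℝ F] {f : E → F} {x : E} {n : ℕ∞ω} (hf : ContDiffAt ℝ n f x) (hn : n ≠ 0)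
    (hinj : Function.Injective (fderiv ℝ f x)) :
    ∃ g : F → E, ContDiffAt ℝ n g (f x) ∧ ∀ᶠ v in 𝓝 x, g (f v) = v := by
  obtain ⟨Λ, hΛ⟩ := ContinuousLinearMap.HasLeftInverse.of_injective_of_finiteDimensional hinj
  have hΛf : ContDiffAt ℝ n (Λ ∘ f) x := Λ.contDiff.contDiffAt.comp x hf
  have hd : HasFDerivAt (Λ ∘ f) (ContinuousLinearEquiv.refl ℝ E : E →L[ℝ] E) x := by
    convert! Λ.hasFDerivAt.comp x (hf.differentiableAt hn).hasFDerivAt using 1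
    ext1 v
    exact (hΛ v).symm
  exact ⟨hΛf.localInverse hd hn ∘ Λ,
    (hΛf.to_localInverse hd hn).comp (f x) Λ.contDiff.contDiffAt,
    (hΛf.hasStrictFDerivAt' hd hn).eventually_left_inverse⟩

namespace NormData

variable {d : ℕ} {M : Type v} [TopologicalSpace M] [ChartedSpace (EuclideanSpace ℝ (Fin d)) M]
  {F : Type*} [NormedAddCommGroup F] [NormedSpace ℝ F] {k : ℕ} {α γ B B' : ℝ}

theorem convex_chartBall (D : NormData d M) (c : M) : Convex ℝ (D.chartBall c) :=
  convex_closedBall _ _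

theorem isCompact_chartBall (D : NormData d M) (c : M) : IsCompact (D.chartBall c) :=
  isCompact_closedBall _ _

theorem exists_mem_chartBall (D : NormData d M) (t : M) : ∃ c ∈ D.centers,
    t ∈ (extChartAt (𝓡 d) c).source ∧ extChartAt (𝓡 d) c t ∈ D.chartBall c := by
  obtain ⟨c, hc, hs, hb⟩ := D.covers t
  exact ⟨c, hc, hs, Metric.ball_subset_closedBall hb⟩

theorem isClosedEmbedding_emb [CompactSpace M] (D : NormData d M) : IsClosedEmbedding D.emb :=
  D.emb_smooth.continuous.isClosedEmbedding D.emb_injective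

/-- A bound for the `C^{k+α}` norm of a vector-valued function on the manifold: in each chart of
`D` its derivatives of order at most `k` are bounded by `B`, and the one of order `k` is
`α`-Hölder with constant `B`. -/
structure MapBound (D : NormData d M) (k : ℕ) (α : ℝ) (u : M → F) (B : ℝ) : Prop where
  nonneg : 0 ≤ B
  jetBound : ∀ c ∈ D.centers,
    JetBound k α (u ∘ (extChartAt (𝓡 d) c).symm) (D.chartBall c) B

namespace MapBound

variable {D : NormData d M} {u u' : M → F}

theorem mono (h : D.MapBound k α u B) (hB : B ≤ B') : D.MapBound k α u B' :=
  ⟨h.nonneg.trans hB, fun c hc => (h.jetBound c hc).mono hB⟩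

theorem add (h : D.MapBound k α u B) (h' : D.MapBound k α u' B') :
    D.MapBound k α (fun t => u t + u' t) (B + B') :=
  ⟨add_nonneg h.nonneg h'.nonneg, fun c hc => (h.jetBound c hc).add (h'.jetBound c hc)⟩

theorem sub (h : D.MapBound k α u B) (h' : D.MapBound k α u' B') :
    D.MapBound k α (fun t => u t - u' t) (B + B') :=
  ⟨add_nonneg h.nonneg h'.nonneg, fun c hc => (h.jetBound c hc).sub (h'.jetBound c hc)⟩

theorem norm_apply_le (h : D.MapBound k α u B) (t : M) : ‖u t‖ ≤ B := by
  obtain ⟨c, hc, hs, hb⟩ := D.exists_mem_chartBall t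
  have := (h.jetBound c hc).norm_apply_le hb
  rwa [Function.comp_apply, PartialEquiv.left_inv _ hs] at this

theorem interpolate {a b : ℝ} (ha : D.MapBound k 0 u a) (hb : D.MapBound k γ u b)
    (hγ : 0 < γ) (hα : 0 ≤ α) (hαγ : α ≤ γ) :
    D.MapBound k α u (a ^ (1 - α / γ) * b ^ (α / γ)) :=
  ⟨mul_nonneg (Real.rpow_nonneg ha.nonneg _) (Real.rpow_nonneg hb.nonneg _),
    fun c hc => (ha.jetBound c hc).interpolate (hb.jetBound c hc) hγ hα hαγ⟩

theorem to_zero (h : D.MapBound k α u B) : D.MapBound k 0 u (2 * B) :=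
  ⟨mul_nonneg zero_le_two h.nonneg, fun c hc =>
    .of_norm_le h.nonneg (h.jetBound c hc).contDiffAt (h.jetBound c hc).norm_le⟩

theorem of_exponent_le (h : D.MapBound k γ u B) (hγ : 0 < γ) (hα : 0 ≤ α) (hαγ : α ≤ γ) :
    D.MapBound k α u (2 * B) := by
  have hB := h.nonneg
  have hexp : 0 ≤ 1 - α / γ := sub_nonneg.2 (div_le_one_of_le₀ hαγ hγ.le)
  refine (h.to_zero.interpolate (h.mono (by linarith : B ≤ 2 * B)) hγ hα hαγ).mono (le_of_eq ?_)
  rw [← Real.rpow_add_of_nonneg (by positivity) hexp (by positivity), sub_add_cancel,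
    Real.rpow_one]

variable [IsManifold (𝓡 d) ∞ M]

theorem contMDiff (h : D.MapBound k α u B) : ContMDiff (𝓡 d) 𝓘(ℝ, F) k u := by
  intro t
  obtain ⟨c, hc, hs, hb⟩ := D.exists_mem_chartBall t
  have hchart : ContMDiffAt (𝓡 d) (𝓡 d) k (extChartAt (𝓡 d) c) t :=
    (contMDiffAt_extChartAt' (n := ∞) (by simpa using hs)).of_le (mod_cast le_top)
  refine (((h.jetBound c hc).contDiffAt _ hb).contMDiffAt.comp t hchart).congr_of_eventuallyEq ?_
  filter_upwards [extChartAt_source_mem_nhds' hs] with y hy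
  rw [Function.comp_apply, Function.comp_apply, PartialEquiv.left_inv _ hy]

end MapBound

/-- `Q` extends the chart of `M` centered at `c` to a `C^n` map defined on the subset `S` of the
ambient space of the embedding. -/
structure IsAmbientChart (D : NormData d M) (n : ℕ)
    (Q : EuclideanSpace ℝ (Fin D.dim) → EuclideanSpace ℝ (Fin d)) (c : M)
    (S : Set (EuclideanSpace ℝ (Fin D.dim))) : Prop where
  mem_centers : c ∈ D.centers
  contDiffAt : ∀ a ∈ S, ContDiffAt ℝ n Q a
  mapsTo : MapsTo Q S (D.chartBall c)
  mem_source : ∀ t, D.emb t ∈ S → t ∈ (extChartAt (𝓡 d) c).source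
  apply_emb : ∀ t, D.emb t ∈ S → Q (D.emb t) = extChartAt (𝓡 d) c t

theorem IsAmbientChart.exists_jetBound_smul {D : NormData d M}
    {Q : EuclideanSpace ℝ (Fin D.dim) → EuclideanSpace ℝ (Fin d)} {c : M}
    {p : EuclideanSpace ℝ (Fin D.dim)} {ε : ℝ} {χ : EuclideanSpace ℝ (Fin D.dim) → ℝ}
    (F : Type*) [NormedAddCommGroup F] [NormedSpace ℝ F]
    (h : D.IsAmbientChart (k + 1) Q c (Metric.closedBall p ε)) (hχ : ContDiff ℝ (k + 1) χ)
    (hsupp : tsupport χ ⊆ Metric.ball p ε) (hk : 1 ≤ k) (hα : 0 ≤ α) (hα' : α ≤ 1) :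
    ∃ C : ℝ, ∀ (u : M → F) (B : ℝ), D.MapBound k α u B →
      JetBound k α (fun a => χ a • u ((extChartAt (𝓡 d) c).symm (Q a))) univ (C * B) := by
  have hball : Metric.ball p ε ⊆ Metric.closedBall p ε := Metric.ball_subset_closedBall
  obtain ⟨L, hL⟩ : ∃ L, JetBound k α Q (Metric.closedBall p ε) L :=
    JetBound.exists_of_isCompact (isCompact_closedBall p ε) (convex_closedBall p ε)
      (mod_cast h.contDiffAt) hα hα'
  obtain ⟨A, hA⟩ : ∃ A, JetBound k α χ (Metric.closedBall p ε) A :=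
    JetBound.exists_of_isCompact (isCompact_closedBall p ε) (convex_closedBall p ε)
      (fun a _ => hχ.contDiffAt) hα hα'
  obtain ⟨Z, hZ⟩ := JetBound.exists_extend_zero F (k := k) (K := tsupport χ)
    ((isCompact_closedBall p ε).of_isClosed_subset (isClosed_tsupport χ) (hsupp.trans hball))
    Metric.isOpen_ball hsupp hα
  refine ⟨Z * (2 ^ (k + 2) * (A * (faaDiBrunoTerms k * (2 * k + 2) * max 1 L ^ (k + α)))),
    fun u B hu => ?_⟩
  have hcomp := (hu.jetBound c h.mem_centers).comp
    ((hL.mono_set hball).mono (le_max_right 1 L)) (D.convex_chartBall c) (convex_ball p ε)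
    (h.mapsTo.mono_left hball) hk hα hα' (le_max_left 1 L)
  refine (hZ _ _ (fun a ha => ?_)
    ((hA.mono_set hball).smul hcomp (convex_ball p ε) hα hα')).mono (le_of_eq ?_)
  · rw [image_eq_zero_of_notMem_tsupport ha, zero_smul]
  · ring

variable [IsManifold (𝓡 d) ∞ M]

theorem contDiffAt_comp_symm (D : NormData d M) {n : ℕ∞} {u : M → F}
    (hu : ContMDiff (𝓡 d) 𝓘(ℝ, F) n u) {c : M} (hc : c ∈ D.centers)
    {x : EuclideanSpace ℝ (Fin d)} (hx : x ∈ D.chartBall c) :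
    ContDiffAt ℝ n (u ∘ (extChartAt (𝓡 d) c).symm) x := by
  have hchart : ContMDiffAt (𝓡 d) (𝓡 d) n (extChartAt (𝓡 d) c).symm x :=
    ((contMDiffOn_extChartAt_symm (n := ∞) c).contMDiffAt ((isOpen_extChartAt_target c).mem_nhds
      (D.closedBall_subset c hc hx))).of_le (mod_cast le_top)
  exact (hu.contMDiffAt.comp x hchart).contDiffAt

theorem exists_mapBound_emb (D : NormData d M) (k : ℕ) (hα : 0 ≤ α) (hα' : α ≤ 1) :
    ∃ B, D.MapBound k α D.emb B := by
  have hloc (c : D.centers) : ∃ B,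
      JetBound k α (D.emb ∘ (extChartAt (𝓡 d) (c : M)).symm) (D.chartBall c) B :=
    JetBound.exists_of_isCompact (D.isCompact_chartBall c) (D.convex_chartBall c) (fun x hx =>
      (D.contDiffAt_comp_symm D.emb_smooth c.2 hx).of_le (mod_cast le_top)) hα hα'
  choose B hB using hloc
  have hB0 (c) : 0 ≤ B c := (hB c).nonneg
  exact ⟨∑ c, B c, Finset.sum_nonneg fun c _ => hB0 c, fun c hc => (hB ⟨c, hc⟩).mono
    (Finset.single_le_sum (fun c _ => hB0 c) (Finset.mem_univ _))⟩

theorem injective_fderiv_emb_comp_symm (D : NormData d M) {c : M} {x : EuclideanSpace ℝ (Fin d)}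
    (hx : x ∈ (extChartAt (𝓡 d) c).target) :
    Function.Injective (fderiv ℝ (D.emb ∘ (extChartAt (𝓡 d) c).symm) x) := by
  have hchart : MDifferentiableAt (𝓡 d) (𝓡 d) (extChartAt (𝓡 d) c).symm x :=
    ((contMDiffOn_extChartAt_symm (n := ∞) c).contMDiffAt
      ((isOpen_extChartAt_target c).mem_nhds hx)).mdifferentiableAt (by simp)
  have hemb : MDifferentiableAt (𝓡 d) (𝓡 D.dim) D.emb ((extChartAt (𝓡 d) c).symm x) :=
    D.emb_smooth.mdifferentiableAt (by simp)
  have hinv := isInvertible_mfderivWithin_extChartAt_symm (I := 𝓡 d) (x := c) hx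
  rw [ModelWithCorners.range_eq_univ, mfderivWithin_univ] at hinv
  rw [← mfderiv_eq_fderiv, mfderiv_comp x hemb hchart]
  exact (D.emb_immersion _).comp hinv.injective

variable [CompactSpace M]

theorem exists_isAmbientChart (D : NormData d M) {n : ℕ} (hn : n ≠ 0) (s : M) :
    ∃ c Q, ∃ ε > 0, D.IsAmbientChart n Q c (Metric.closedBall (D.emb s) ε) := by
  obtain ⟨c, hc, hs, hb⟩ := D.covers s
  have hsymm : (extChartAt (𝓡 d) c).symm (extChartAt (𝓡 d) c s) = s :=
    (extChartAt (𝓡 d) c).left_inv hs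
  have hp := (D.contDiffAt_comp_symm D.emb_smooth hc (Metric.ball_subset_closedBall hb)).of_le
    (show ((n : ℕ∞) : ℕ∞ω) ≤ _ by exact_mod_cast le_top)
  obtain ⟨Q, hQ, hinv⟩ := exists_contDiffAt_eventually_leftInverse hp (mod_cast hn)
    (D.injective_fderiv_emb_comp_symm ((extChartAt (𝓡 d) c).map_source hs))
  rw [Function.comp_apply, hsymm] at hQ
  have hchart : ∀ᶠ t in 𝓝 s, t ∈ (extChartAt (𝓡 d) c).source ∧
      Q (D.emb t) = extChartAt (𝓡 d) c t := by
    filter_upwards [extChartAt_source_mem_nhds' hs,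
      (continuousAt_extChartAt' hs).eventually hinv] with t ht h
    rw [Function.comp_apply, PartialEquiv.left_inv _ ht] at h
    exact ⟨ht, h⟩
  have hball : ∀ᶠ a in 𝓝 (D.emb s), Q a ∈ D.chartBall c := by
    refine hQ.continuousAt.eventually_mem ?_
    rw [hchart.self_of_nhds.2]
    exact mem_of_superset (Metric.isOpen_ball.mem_nhds hb) Metric.ball_subset_closedBall
  rw [D.isClosedEmbedding_emb.isInducing.nhds_eq_comap, eventually_comap] at hchart
  obtain ⟨ε, hε, h⟩ := Metric.nhds_basis_closedBall.eventually_iff.1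
    (hball.and ((hQ.eventually (by simp)).and hchart))
  exact ⟨c, Q, ε, hε, hc, fun a ha => (h ha).2.1, fun a ha => (h ha).1,
    fun t ht => ((h ht).2.2 t rfl).1, fun t ht => ((h ht).2.2 t rfl).2⟩

theorem exists_partition_isAmbientChart (D : NormData d M) {n : ℕ} (hn : n ≠ 0) :
    ∃ (I : Finset M) (χ : I → EuclideanSpace ℝ (Fin D.dim) → ℝ) (c : I → M)
      (Q : I → EuclideanSpace ℝ (Fin D.dim) → EuclideanSpace ℝ (Fin d)) (ε : I → ℝ),
      (∀ s, ContDiff ℝ ∞ (χ s)) ∧ (∀ t, ∑ s, χ s (D.emb t) = 1) ∧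
      ∀ s, tsupport (χ s) ⊆ Metric.ball (D.emb s) (ε s) ∧
        D.IsAmbientChart n (Q s) (c s) (Metric.closedBall (D.emb s) (ε s)) := by
  choose c Q ε hε hQ using D.exists_isAmbientChart hn
  obtain ⟨I, hI⟩ := (isCompact_range D.emb_smooth.continuous).elim_finite_subcover
    (fun s : M => Metric.ball (D.emb s) (ε s)) (fun s => Metric.isOpen_ball) (by
      rintro _ ⟨t, rfl⟩
      exact mem_iUnion.2 ⟨t, Metric.mem_ball_self (hε t)⟩)
  obtain ⟨χ, hχ⟩ := SmoothPartitionOfUnity.exists_isSubordinate (𝓡 D.dim)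
    D.isClosedEmbedding_emb.isClosed_range (fun s : I => Metric.ball (D.emb s) (ε s))
    (fun s => Metric.isOpen_ball) (by simpa only [iUnion_subtype] using hI)
  refine ⟨I, fun s => χ s, fun s => c s, fun s => Q s, fun s => ε s,
    fun s => (χ s).contMDiff.contDiff, fun t => ?_, fun s => ⟨hχ s, hQ s⟩⟩
  rw [← finsum_eq_sum_of_fintype]
  exact χ.sum_eq_one (mem_range_self t)

theorem exists_extension (D : NormData d M) (F : Type*) [NormedAddCommGroup F] [NormedSpace ℝ F]
    (hk : 1 ≤ k) (hα : 0 ≤ α) (hα' : α ≤ 1) :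
    ∃ C : ℝ, ∀ (u : M → F) (B : ℝ), D.MapBound k α u B →
      ∃ g : EuclideanSpace ℝ (Fin D.dim) → F,
        (∀ t, g (D.emb t) = u t) ∧ JetBound k α g univ (C * B) := by
  obtain ⟨I, χ, c, Q, ε, hχ, hsum, hQ⟩ := D.exists_partition_isAmbientChart k.succ_ne_zero
  choose C hC using fun s => (hQ s).2.exists_jetBound_smul F
    ((hχ s).of_le (mod_cast le_top)) (hQ s).1 hk hα hα'
  refine ⟨∑ s, C s, fun u B hu =>
    ⟨fun a => ∑ s, χ s a • u ((extChartAt (𝓡 d) (c s)).symm (Q s a)), fun t => ?_, ?_⟩⟩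
  · have hterm (s : I) : χ s (D.emb t) • u ((extChartAt (𝓡 d) (c s)).symm (Q s (D.emb t))) =
        χ s (D.emb t) • u t := by
      by_cases hs : χ s (D.emb t) = 0
      · rw [hs, zero_smul, zero_smul]
      · have ht := Metric.ball_subset_closedBall ((hQ s).1 (subset_tsupport _ hs))
        rw [(hQ s).2.apply_emb t ht, PartialEquiv.left_inv _ ((hQ s).2.mem_source t ht)]
    simp_rw [hterm]
    rw [← Finset.sum_smul, hsum, one_smul]
  · rw [Finset.sum_mul]
    exact .sum _ fun s _ => hC s u B hu

/-! ## Composition estimates on the manifold -/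

theorem exists_mapBound_comp (D : NormData d M) (F : Type*) [NormedAddCommGroup F]
    [NormedSpace ℝ F] (hk : 1 ≤ k) (hα : 0 ≤ α) (hα' : α ≤ 1) :
    ∃ C : ℝ, ∀ (u : M → F) (φ : M → M) (B L : ℝ), 1 ≤ L → D.MapBound k α u B →
      D.MapBound k α (D.emb ∘ φ) L → D.MapBound k α (u ∘ φ) (C * (B * L ^ (k + α))) := by
  obtain ⟨C, h⟩ := D.exists_extension F hk hα hα'
  refine ⟨faaDiBrunoTerms k * (2 * k + 2) * |C|, fun u φ B L hL hu hφ => ?_⟩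
  obtain ⟨g, hg, hgB⟩ := h u B hu
  have hB := hu.nonneg
  have hT := faaDiBrunoTerms_nonneg k
  refine ⟨by positivity, fun c hc => ?_⟩
  have hcomp := hgB.comp (hφ.jetBound c hc) convex_univ (D.convex_chartBall c) (mapsTo_univ _ _)
    hk hα hα' hL
  have heq : g ∘ (D.emb ∘ φ) ∘ (extChartAt (𝓡 d) c).symm = (u ∘ φ) ∘ (extChartAt (𝓡 d) c).symm :=
    funext fun x => hg _
  rw [heq] at hcomp
  refine hcomp.mono ?_
  rw [mul_assoc, mul_assoc, mul_assoc, mul_assoc]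
  gcongr
  exact le_abs_self C

theorem exists_mapBound_comp_sub_comp (D : NormData d M) (F : Type*) [NormedAddCommGroup F]
    [NormedSpace ℝ F] (hk : 1 ≤ k) (hα : 0 ≤ α) (hαγ : α ≤ γ) (hγ : 0 < γ) (hγ' : γ ≤ 1) :
    ∃ C : ℝ, ∀ (u : M → F) (φ ψ : M → M) (B L δ : ℝ), 1 ≤ L → D.MapBound k γ u B →
      D.MapBound k γ (D.emb ∘ φ) L → D.MapBound k γ (D.emb ∘ ψ) L →
      D.MapBound k 0 (fun t => D.emb (φ t) - D.emb (ψ t)) δ →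
      D.MapBound k α (fun t => u (φ t) - u (ψ t)) (C * (B * L ^ (k + γ) * δ ^ (γ - α))) := by
  obtain ⟨C, h⟩ := D.exists_extension F hk hγ.le hγ'
  refine ⟨2 * (faaDiBrunoTerms k * (2 * k + 2) * |C|), fun u φ ψ B L δ hL hu hφ hψ hφψ => ?_⟩
  obtain ⟨g, hg, hgB⟩ := h u B hu
  have hB := hu.nonneg
  have hδ := hφψ.nonneg
  have hT := faaDiBrunoTerms_nonneg k
  refine ⟨by positivity, fun c hc => ?_⟩
  have hcomp := hgB.comp_sub_comp (hφ.jetBound c hc) (hψ.jetBound c hc) (hφψ.jetBound c hc)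
    convex_univ (D.convex_chartBall c) (mapsTo_univ _ _) (mapsTo_univ _ _) hk hα hαγ hγ hγ' hL
  simp only [Function.comp_apply, hg] at hcomp
  refine hcomp.mono ?_
  calc _ = 2 * (faaDiBrunoTerms k * (2 * k + 2) * C) * (B * L ^ (k + γ) * δ ^ (γ - α)) := by ring
    _ ≤ _ := by gcongr; exact le_abs_self C

theorem exists_mapBound_tsum (D : NormData d M) (F : Type*) [NormedAddCommGroup F]
    [NormedSpace ℝ F] [CompleteSpace F] (hk : 1 ≤ k) (hα : 0 ≤ α) (hα' : α ≤ 1) :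
    ∃ C : ℝ, ∀ (u : ℕ → M → F) (b : ℕ → ℝ), (∀ n, D.MapBound k α (u n) (b n)) → Summable b →
      D.MapBound k α (fun t => ∑' n, u n t) (C * ∑' n, b n) := by
  obtain ⟨C, h⟩ := D.exists_extension F hk hα hα'
  obtain ⟨B₀, hB₀⟩ := D.exists_mapBound_emb k hα hα'
  have hT := faaDiBrunoTerms_nonneg k
  refine ⟨faaDiBrunoTerms k * (2 * k + 2) * (|C| * max 1 B₀ ^ (k + α)), fun u b hu hb => ?_⟩
  choose g hg hgB using fun n => h (u n) (b n) (hu n)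
  have hb0 : 0 ≤ ∑' n, b n := tsum_nonneg fun n => (hu n).nonneg
  refine ⟨by positivity, fun c hc => ?_⟩
  have hsum := (JetBound.tsum hgB (hb.mul_left C)).comp
    ((hB₀.jetBound c hc).mono (le_max_right 1 B₀)) convex_univ (D.convex_chartBall c)
    (mapsTo_univ _ _) hk hα hα' (le_max_left 1 B₀)
  have heq : (fun x => ∑' n, g n x) ∘ D.emb ∘ (extChartAt (𝓡 d) c).symm =
      (fun t => ∑' n, u n t) ∘ (extChartAt (𝓡 d) c).symm := by
    ext1 x
    simp only [Function.comp_apply, hg]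
  rw [heq, tsum_mul_left] at hsum
  refine hsum.mono ?_
  calc _ = faaDiBrunoTerms k * (2 * k + 2) * (C * max 1 B₀ ^ (k + α)) * ∑' n, b n := by ring
    _ ≤ _ := by gcongr; exact le_abs_self C

theorem exists_mapBound_sub_of_tendsto (D : NormData d M) (F : Type*) [NormedAddCommGroup F]
    [NormedSpace ℝ F] [CompleteSpace F] (hk : 1 ≤ k) (hα : 0 ≤ α) (hα' : α ≤ 1) :
    ∃ C : ℝ, ∀ (u : ℕ → M → F) (U : M → F) (b : ℕ → ℝ),
      (∀ n, D.MapBound k α (fun t => u (n + 1) t - u n t) (b n)) → Summable b →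
      (∀ t, Tendsto (fun n => u n t) atTop (𝓝 (U t))) →
      ∀ n, D.MapBound k α (fun t => U t - u n t) (C * ∑' m, b (m + n)) := by
  obtain ⟨C, hC⟩ := D.exists_mapBound_tsum F hk hα hα'
  refine ⟨C, fun u U b hu hb hU n => ?_⟩
  have htail := hC (fun m t => u (m + n + 1) t - u (m + n) t) (fun m => b (m + n))
    (fun m => hu (m + n)) ((summable_nat_add_iff n).2 hb)
  convert htail using 2 with t
  have hs : Summable fun m => u (m + n + 1) t - u (m + n) t :=
    .of_norm_bounded ((summable_nat_add_iff n).2 hb) fun m => (hu (m + n)).norm_apply_le t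
  refine tendsto_nhds_unique ?_ hs.hasSum.tendsto_sum_nat
  have htel (N : ℕ) : ∑ m ∈ Finset.range N, (u (m + n + 1) t - u (m + n) t) =
      u (N + n) t - u n t := by
    rw [Finset.sum_congr rfl fun m _ => by rw [add_right_comm],
      Finset.sum_range_sub (fun m => u (m + n) t), zero_add]
  simp only [htel]
  exact ((tendsto_add_atTop_iff_nat n).2 (hU t)).sub_const _

end NormData

/-! ## Bounds for diffeomorphisms and their differences -/

namespace NormData

variable {d : ℕ} {M : Type v} [TopologicalSpace M] [ChartedSpace (EuclideanSpace ℝ (Fin d)) M]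
  {D : NormData d M} {k : ℕ} {α γ B B' : ℝ}

theorem norm_chartDeriv_le_of_vecNorm_le {u : M → EuclideanSpace ℝ (Fin D.dim)} (hB : 0 ≤ B)
    (h : D.vecNorm k α u ≤ ENNReal.ofReal B) {c : M} (hc : c ∈ D.centers) {j : ℕ} (hj : j ≤ k)
    {x : EuclideanSpace ℝ (Fin d)} (hx : x ∈ D.chartBall c) : ‖D.chartDeriv u j c x‖ ≤ B := by
  rw [← ENNReal.ofReal_le_ofReal_iff hB]
  refine le_trans ?_ h
  rcases Nat.eq_zero_or_pos j with rfl | hj0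
  · rw [chartDeriv, norm_iteratedFDeriv_zero, ofReal_norm]
    exact (le_iSup (fun t => ‖u t‖ₑ) _).trans le_self_add
  · rw [ofReal_norm]
    refine le_trans ?_ (le_self_add.trans le_add_self)
    exact le_iSup₂_of_le j (Finset.mem_Icc.2 ⟨hj0, hj⟩)
      (le_iSup₂_of_le c hc (le_iSup₂_of_le x hx le_rfl))

theorem norm_chartDeriv_sub_le_of_vecNorm_le {u : M → EuclideanSpace ℝ (Fin D.dim)} (hB : 0 ≤ B)
    (hα : α ≠ 0) (h : D.vecNorm k α u ≤ ENNReal.ofReal B) {c : M} (hc : c ∈ D.centers)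
    {x y : EuclideanSpace ℝ (Fin d)} (hx : x ∈ D.chartBall c) (hy : y ∈ D.chartBall c) :
    ‖D.chartDeriv u k c x - D.chartDeriv u k c y‖ ≤ B * ‖x - y‖ ^ α := by
  rcases eq_or_ne x y with rfl | hxy
  · rw [sub_self, norm_zero]
    positivity
  have hquot : ‖D.chartDeriv u k c x - D.chartDeriv u k c y‖ₑ / edist x y ^ α
      ≤ ENNReal.ofReal B := by
    refine le_trans ?_ (le_add_self.trans (le_add_self.trans h))
    rw [if_neg hα]
    refine le_iSup₂_of_le c hc (le_iSup₂_of_le x hx (le_iSup₂_of_le y hy ?_))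
    exact le_iSup_of_le hxy le_rfl
  have hpos : 0 < ‖x - y‖ := norm_sub_pos_iff.2 hxy
  rwa [edist_eq_enorm_sub, ← ofReal_norm, ← ofReal_norm, ENNReal.ofReal_rpow_of_pos hpos,
    ← ENNReal.ofReal_div_of_pos (by positivity), ENNReal.ofReal_le_ofReal_iff hB,
    div_le_iff₀ (by positivity)] at hquot

theorem MapBound.of_vecNorm_le [IsManifold (𝓡 d) ∞ M] {u : M → EuclideanSpace ℝ (Fin D.dim)}
    (hu : ContMDiff (𝓡 d) (𝓡 D.dim) k u) (hB : 0 ≤ B)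
    (h : D.vecNorm k α u ≤ ENNReal.ofReal B) : D.MapBound k α u (2 * B) := by
  have hB2 : B ≤ 2 * B := by linarith
  refine ⟨by positivity, fun c hc => ⟨by positivity,
    fun x hx => mod_cast D.contDiffAt_comp_symm (n := k) hu hc hx,
    fun j hj x hx => (norm_chartDeriv_le_of_vecNorm_le hB h hc hj hx).trans hB2,
    fun x hx y hy => ?_⟩⟩
  rcases eq_or_ne α 0 with rfl | hα
  · rw [Real.rpow_zero, mul_one, two_mul]
    exact norm_sub_le_of_le (norm_chartDeriv_le_of_vecNorm_le hB h hc le_rfl hx)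
      (norm_chartDeriv_le_of_vecNorm_le hB h hc le_rfl hy)
  · exact (norm_chartDeriv_sub_le_of_vecNorm_le hB hα h hc hx hy).trans (by gcongr)

theorem MapBound.vecNorm_le {u : M → EuclideanSpace ℝ (Fin D.dim)} (h : D.MapBound k α u B) :
    D.vecNorm k α u ≤ ENNReal.ofReal (3 * B) := by
  have hB := h.nonneg
  rw [show 3 * B = B + (B + B) by ring, ENNReal.ofReal_add hB (by positivity),
    ENNReal.ofReal_add hB hB]
  refine add_le_add (iSup_le fun t => ?_) (add_le_add ?_ ?_)
  · rw [← ofReal_norm]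
    exact ENNReal.ofReal_le_ofReal (h.norm_apply_le t)
  · refine iSup₂_le fun j hj => iSup₂_le fun c hc => iSup₂_le fun x hx => ?_
    rw [← ofReal_norm]
    exact ENNReal.ofReal_le_ofReal ((h.jetBound c hc).norm_le j (Finset.mem_Icc.1 hj).2 x hx)
  · split_ifs
    · exact zero_le
    refine iSup₂_le fun c hc => iSup₂_le fun x hx => iSup₂_le fun y hy => iSup_le fun hxy => ?_
    have hpos : 0 < ‖x - y‖ := norm_sub_pos_iff.2 hxy
    rw [edist_eq_enorm_sub, ← ofReal_norm, ← ofReal_norm, ENNReal.ofReal_rpow_of_pos hpos,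
      ← ENNReal.ofReal_div_of_pos (by positivity)]
    exact ENNReal.ofReal_le_ofReal
      ((div_le_iff₀ (by positivity)).2 ((h.jetBound c hc).holder x hx y hy))

theorem contMDiff_of_contMDiff_emb_comp [IsManifold (𝓡 d) ∞ M] [CompactSpace M]
    (D : NormData d M) (hk : k ≠ 0) {g : M → M} (hg : Continuous g)
    (h : ContMDiff (𝓡 d) (𝓡 D.dim) k (D.emb ∘ g)) : ContMDiff (𝓡 d) (𝓡 d) k g := by
  intro t
  obtain ⟨c, Q, ε, hε, hQ⟩ := D.exists_isAmbientChart hk (g t)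
  have hmem : D.emb (g t) ∈ Metric.closedBall (D.emb (g t)) ε := Metric.mem_closedBall_self hε.le
  have hQg : ContMDiffAt (𝓡 d) (𝓡 d) k (fun t => Q (D.emb (g t))) t :=
    (hQ.contDiffAt _ hmem).contMDiffAt.comp t (h t)
  have hchart : ContMDiffAt (𝓡 d) (𝓡 d) k (extChartAt (𝓡 d) c).symm (Q (D.emb (g t))) :=
    ((contMDiffOn_extChartAt_symm (n := ∞) c).contMDiffAt ((isOpen_extChartAt_target c).mem_nhds
      (D.closedBall_subset c hQ.mem_centers (hQ.mapsTo hmem)))).of_le (mod_cast le_top)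
  refine (hchart.comp t hQg).congr_of_eventuallyEq ?_
  have hnear : ∀ᶠ s in 𝓝 t, D.emb (g s) ∈ Metric.closedBall (D.emb (g t)) ε :=
    (D.emb_smooth.continuous.comp hg).continuousAt.eventually_mem (Metric.closedBall_mem_nhds _ hε)
  filter_upwards [hnear] with s hs
  rw [Function.comp_apply, hQ.apply_emb _ hs, PartialEquiv.left_inv _ (hQ.mem_source _ hs)]

/-- A bound for the `C^{k+α}` size of `g`: unlike `NormData.size`, it is stated in terms of the
vector-valued functions `emb ∘ g` and `emb ∘ g⁻¹`. -/
structure SizeBound (D : NormData d M) (k : ℕ) (α : ℝ) (g : M ≃ₜ M) (B : ℝ) : Prop where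
  map : D.MapBound k α (D.emb ∘ g) B
  symm : D.MapBound k α (D.emb ∘ g.symm) B

/-- A bound for the `C^{k+α}` distances between `g` and `h` and between their inverses. -/
structure DiffBound (D : NormData d M) (k : ℕ) (α : ℝ) (g h : M ≃ₜ M) (B : ℝ) : Prop where
  map : D.MapBound k α (fun t => D.emb (g t) - D.emb (h t)) B
  symm : D.MapBound k α (fun t => D.emb (g.symm t) - D.emb (h.symm t)) B

variable {g h g' h' : M ≃ₜ M}

namespace SizeBound

theorem mono (hg : D.SizeBound k α g B) (hB : B ≤ B') : D.SizeBound k α g B' :=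
  ⟨hg.map.mono hB, hg.symm.mono hB⟩

theorem inv (hg : D.SizeBound k α g B) : D.SizeBound k α g⁻¹ B := ⟨hg.symm, hg.map⟩

theorem of_size_le [IsManifold (𝓡 d) ∞ M] {S : ℝ} (hg : ContMDiff (𝓡 d) (𝓡 d) k g)
    (hg' : ContMDiff (𝓡 d) (𝓡 d) k g.symm) (hemb : D.MapBound k α D.emb B) (hS : 0 ≤ S)
    (h : D.size k α g ≤ ENNReal.ofReal S) : D.SizeBound k α g (2 * (B + S)) := by
  have hsmooth : ContMDiff (𝓡 d) (𝓡 D.dim) k D.emb := D.emb_smooth.of_le (mod_cast le_top)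
  have hBS : 0 ≤ B + S := add_nonneg hemb.nonneg hS
  have hvec (g : M → M) (hgS : D.mapNorm k α g ≤ ENNReal.ofReal S) :
      D.vecNorm k α (D.emb ∘ g) ≤ ENNReal.ofReal (B + S) := by
    rw [ENNReal.ofReal_add hemb.nonneg hS]
    refine add_le_add (iSup_le fun t => ?_) (le_add_self.trans hgS)
    rw [← ofReal_norm]
    exact ENNReal.ofReal_le_ofReal (hemb.norm_apply_le _)
  exact ⟨.of_vecNorm_le (hsmooth.comp hg) hBS (hvec _ (le_self_add.trans h)),
    .of_vecNorm_le (hsmooth.comp hg') hBS (hvec _ (le_add_self.trans h))⟩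

theorem mapNorm_lt_top (hg : D.SizeBound k α g B) : D.mapNorm k α g < ⊤ := by
  have hdisp : (⨆ t : M, edist (D.emb (g t)) (D.emb t)) ≤ ENNReal.ofReal (B + B) := by
    refine iSup_le fun t => ?_
    rw [edist_eq_enorm_sub, ← ofReal_norm]
    have ht := hg.map.norm_apply_le (g.symm t)
    rw [Function.comp_apply, g.apply_symm_apply] at ht
    exact ENNReal.ofReal_le_ofReal (norm_sub_le_of_le (hg.map.norm_apply_le t) ht)
  exact ENNReal.add_lt_top.2 ⟨hdisp.trans_lt ENNReal.ofReal_lt_top,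
    (le_add_self.trans hg.map.vecNorm_le).trans_lt ENNReal.ofReal_lt_top⟩

theorem memDiff [IsManifold (𝓡 d) ∞ M] [CompactSpace M] (hg : D.SizeBound k α g B)
    (hk : k ≠ 0) : D.MemDiff k α g :=
  ⟨D.contMDiff_of_contMDiff_emb_comp hk g.continuous hg.map.contMDiff,
    D.contMDiff_of_contMDiff_emb_comp hk g.symm.continuous hg.symm.contMDiff,
    ENNReal.add_lt_top.2 ⟨hg.mapNorm_lt_top, hg.inv.mapNorm_lt_top⟩⟩

end SizeBound

namespace DiffBound

theorem mono (hgh : D.DiffBound k α g h B) (hB : B ≤ B') : D.DiffBound k α g h B' :=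
  ⟨hgh.map.mono hB, hgh.symm.mono hB⟩

theorem refl (D : NormData d M) (k : ℕ) (α : ℝ) (g : M ≃ₜ M) : D.DiffBound k α g g 0 := by
  have hzero : D.MapBound k α (fun _ => (0 : EuclideanSpace ℝ (Fin D.dim))) 0 :=
    ⟨le_rfl, fun _ _ => .zero⟩
  constructor <;> simpa only [sub_self] using hzero

theorem inv (hgh : D.DiffBound k α g h B) : D.DiffBound k α g⁻¹ h⁻¹ B := ⟨hgh.symm, hgh.map⟩

theorem comm (hgh : D.DiffBound k α g h B) : D.DiffBound k α h g B := by
  have hgg := refl D k α g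
  constructor
  · simpa using (hgg.map.sub hgh.map)
  · simpa using (hgg.symm.sub hgh.symm)

theorem trans (hgg' : D.DiffBound k α g g' B) (hg'h : D.DiffBound k α g' h B') :
    D.DiffBound k α g h (B + B') :=
  ⟨by simpa using hgg'.map.add hg'h.map, by simpa using hgg'.symm.add hg'h.symm⟩

theorem sizeBound (hgh : D.DiffBound k α g h B) (hh : D.SizeBound k α h B') :
    D.SizeBound k α g (B + B') :=
  ⟨by simpa [Function.comp_def] using hgh.map.add hh.map,
    by simpa [Function.comp_def] using hgh.symm.add hh.symm⟩

theorem of_exponent_le (hgh : D.DiffBound k γ g h B) (hγ : 0 < γ) (hα : 0 ≤ α) (hαγ : α ≤ γ) :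
    D.DiffBound k α g h (2 * B) :=
  ⟨hgh.map.of_exponent_le hγ hα hαγ, hgh.symm.of_exponent_le hγ hα hαγ⟩

theorem diffDist_le (hgh : D.DiffBound k α g h B) :
    D.diffDist k α g h ≤ ENNReal.ofReal (6 * B) := by
  have hB := hgh.map.nonneg
  rw [show 6 * B = 3 * B + 3 * B by ring, ENNReal.ofReal_add (by positivity) (by positivity)]
  exact add_le_add hgh.map.vecNorm_le hgh.symm.vecNorm_le

theorem of_diffDist_le [IsManifold (𝓡 d) ∞ M] (hg : D.MemDiff k α g) (hh : D.MemDiff k α h)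
    (hB : 0 ≤ B) (hgh : D.diffDist k α g h ≤ ENNReal.ofReal B) : D.DiffBound k α g h (2 * B) := by
  have hemb : ContMDiff (𝓡 d) (𝓡 D.dim) k D.emb := D.emb_smooth.of_le (mod_cast le_top)
  exact ⟨.of_vecNorm_le ((hemb.comp hg.contMDiff).sub (hemb.comp hh.contMDiff)) hB
      (le_self_add.trans hgh),
    .of_vecNorm_le ((hemb.comp hg.contMDiff_symm).sub (hemb.comp hh.contMDiff_symm)) hB
      (le_add_self.trans hgh)⟩

end DiffBound

theorem exists_modulus_comp [IsManifold (𝓡 d) ∞ M] [CompactSpace M] (D : NormData d M)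
    (F : Type*) [NormedAddCommGroup F] [NormedSpace ℝ F] (hk : 1 ≤ k) (hα : 0 ≤ α) (hαγ : α < γ)
    (hγ' : γ ≤ 1) (L : ℝ) :
    ∃ κ : ℝ → ℝ, Tendsto κ (𝓝 0) (𝓝 0) ∧ ∀ (u u' : M → F) (φ ψ : M → M) (δ : ℝ),
      D.MapBound k γ u' L → D.MapBound k γ (D.emb ∘ φ) L → D.MapBound k γ (D.emb ∘ ψ) L →
      D.MapBound k α (fun t => u t - u' t) δ →
      D.MapBound k α (fun t => D.emb (φ t) - D.emb (ψ t)) δ →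
      D.MapBound k α (fun t => u (φ t) - u' (ψ t)) (κ δ) := by
  have hγ : 0 < γ := hα.trans_lt hαγ
  obtain ⟨C₁, hC₁⟩ := D.exists_mapBound_comp F hk hα (hαγ.le.trans hγ')
  obtain ⟨C₂, hC₂⟩ := D.exists_mapBound_comp_sub_comp F hk hα hαγ.le hγ hγ'
  set Λ := max 1 L
  have hL : L ≤ Λ := le_max_right 1 L
  have hΛ1 : 1 ≤ Λ := le_max_left 1 L
  refine ⟨fun δ => C₁ * (δ * (2 * Λ) ^ (k + α)) + C₂ * (Λ * Λ ^ (k + γ) * (2 * δ) ^ (γ - α)), ?_,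
    fun u u' φ ψ δ hu' hφ hψ huu' hφψ => ?_⟩
  · have hpow := (continuous_id.const_mul (2 : ℝ)).rpow_const
      fun _ => Or.inr (sub_nonneg.2 hαγ.le)
    have hcont : Continuous fun δ : ℝ =>
        C₁ * (δ * (2 * Λ) ^ (k + α)) + C₂ * (Λ * Λ ^ (k + γ) * (2 * δ) ^ (γ - α)) :=
      ((continuous_id.mul_const _).const_mul _).add ((hpow.const_mul _).const_mul _)
    simpa [Real.zero_rpow (sub_pos.2 hαγ).ne'] using hcont.tendsto 0
  · have houter := hC₁ _ φ δ (2 * Λ) (by linarith) huu'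
      ((hφ.mono hL).of_exponent_le hγ hα hαγ.le)
    have hinner := hC₂ u' φ ψ Λ Λ (2 * δ) hΛ1 (hu'.mono hL) (hφ.mono hL) (hψ.mono hL)
      hφψ.to_zero
    simpa using houter.add hinner

theorem exists_modulus_mul [IsManifold (𝓡 d) ∞ M] [CompactSpace M] (D : NormData d M)
    (hk : 1 ≤ k) (hα : 0 ≤ α) (hαγ : α < γ) (hγ' : γ ≤ 1) (L : ℝ) :
    ∃ κ : ℝ → ℝ, Tendsto κ (𝓝 0) (𝓝 0) ∧ ∀ (g g' h h' : M ≃ₜ M) (δ : ℝ),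
      D.SizeBound k γ g L → D.SizeBound k γ g' L → D.SizeBound k γ h L → D.SizeBound k γ h' L →
      D.DiffBound k α g g' δ → D.DiffBound k α h h' δ →
      D.DiffBound k α (g * h) (g' * h') (κ δ) := by
  obtain ⟨κ, hκ, H⟩ := D.exists_modulus_comp (EuclideanSpace ℝ (Fin D.dim)) hk hα hαγ hγ' L
  exact ⟨κ, hκ, fun g g' h h' δ hg hg' hh hh' hgg' hhh' =>
    ⟨H (D.emb ∘ g) (D.emb ∘ g') h h' δ hg'.map hh.map hh'.map hgg'.map hhh'.map,
      H (D.emb ∘ h.symm) (D.emb ∘ h'.symm) g.symm g'.symm δ hh'.symm hg.symm hg'.symm hhh'.symm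
        hgg'.symm⟩⟩

/-- Convergence `G p → g` in the `C^{k+α}` topology along the filter `l`. -/
def TendstoDiff {P : Type*} (D : NormData d M) (k : ℕ) (α : ℝ) (G : P → M ≃ₜ M) (l : Filter P)
    (g : M ≃ₜ M) : Prop :=
  ∀ ε > 0, ∀ᶠ p in l, D.DiffBound k α (G p) g ε

namespace TendstoDiff

variable {P P' : Type*} {l : Filter P} {G H : P → M ≃ₜ M}

theorem const (D : NormData d M) (k : ℕ) (α : ℝ) (l : Filter P) (g : M ≃ₜ M) :
    D.TendstoDiff k α (fun _ => g) l g :=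
  fun _ hε => Eventually.of_forall fun _ => (DiffBound.refl D k α g).mono (le_of_lt hε)

theorem of_tendsto_zero {b : P → ℝ} (h : ∀ p, D.DiffBound k α (G p) g (b p))
    (hb : Tendsto b l (𝓝 0)) : D.TendstoDiff k α G l g :=
  fun _ hε => (hb.eventually_lt_const hε).mono fun p hp => (h p).mono hp.le

theorem comp_tendsto (h : D.TendstoDiff k α G l g) {l' : Filter P'} {s : P' → P}
    (hs : Tendsto s l' l) : D.TendstoDiff k α (fun p => G (s p)) l' g :=
  fun ε hε => hs.eventually (h ε hε)

theorem inv (h : D.TendstoDiff k α G l g) : D.TendstoDiff k α (fun p => (G p)⁻¹) l g⁻¹ :=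
  fun ε hε => (h ε hε).mono fun _ => DiffBound.inv

theorem mul [IsManifold (𝓡 d) ∞ M] [CompactSpace M] (hG : D.TendstoDiff k α G l g)
    (hH : D.TendstoDiff k α H l h) (hk : 1 ≤ k) (hα : 0 ≤ α) (hαγ : α < γ) (hγ' : γ ≤ 1)
    (hGB : ∀ p, D.SizeBound k γ (G p) B) (hg : D.SizeBound k γ g B)
    (hHB : ∀ p, D.SizeBound k γ (H p) B') (hh : D.SizeBound k γ h B') :
    D.TendstoDiff k α (fun p => G p * H p) l (g * h) := by
  obtain ⟨κ, hκ, hmul⟩ := D.exists_modulus_mul hk hα hαγ hγ' (max B B')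
  have hB : B ≤ max B B' := le_max_left _ _
  have hB' : B' ≤ max B B' := le_max_right _ _
  intro ε hε
  obtain ⟨δ, hδε, hδ⟩ := (((hκ.mono_left nhdsWithin_le_nhds).eventually_lt_const hε).and
    (self_mem_nhdsWithin (s := Ioi 0))).exists
  filter_upwards [hG δ hδ, hH δ hδ] with p hGp hHp
  exact (hmul _ _ _ _ δ ((hGB p).mono hB) (hg.mono hB) ((hHB p).mono hB') (hh.mono hB') hGp
    hHp).mono hδε.le

theorem tendsto_diffDist (h : D.TendstoDiff k α G l g) :
    Tendsto (fun p => D.diffDist k α (G p) g) l (𝓝 0) := by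
  refine ENNReal.tendsto_nhds_zero.2 fun ε hε => ?_
  obtain ⟨δ, -, hδ, hδε⟩ := ENNReal.lt_iff_exists_real_btwn.1 hε
  filter_upwards [h (δ / 6) (by linarith [ENNReal.ofReal_pos.1 hδ])] with p hp
  exact (hp.diffDist_le.trans_eq (by ring_nf)).trans hδε.le

end TendstoDiff

end NormData

theorem exists_continuous_tendstoUniformly {M E : Type*} [TopologicalSpace M] [MetricSpace E]
    [CompleteSpace E] {e : M → E} (he : IsClosedEmbedding e) {g : ℕ → M → M}
    (hg : ∀ n, Continuous (g n)) {b : ℕ → ℝ} (hb : Summable b)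
    (h : ∀ n t, dist (e (g n t)) (e (g (n + 1) t)) ≤ b n) :
    ∃ G : M → M, Continuous G ∧ TendstoUniformly (fun n => e ∘ g n) (e ∘ G) atTop := by
  have hlim (t : M) : ∃ s, Tendsto (fun n => e (g n t)) atTop (𝓝 (e s)) := by
    obtain ⟨z, hz⟩ := cauchySeq_tendsto_of_complete
      (cauchySeq_of_dist_le_of_summable b (fun n => h n t) hb)
    obtain ⟨s, rfl⟩ := he.isClosed_range.mem_of_tendsto hz
      (Eventually.of_forall fun n => mem_range_self _)
    exact ⟨s, hz⟩
  choose G hG using hlim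
  have hunif : TendstoUniformly (fun n => e ∘ g n) (e ∘ G) atTop := by
    rw [Metric.tendstoUniformly_iff]
    intro ε hε
    have htail : Tendsto (fun n => ∑' m, b (n + m)) atTop (𝓝 0) := by
      simpa only [add_comm] using tendsto_sum_nat_add b
    filter_upwards [htail.eventually_lt_const hε] with n hn t
    rw [dist_comm]
    exact (dist_le_tsum_of_dist_le_of_tendsto b (fun n => h n t) hb (hG t) n).trans_lt hn
  exact ⟨G, he.isInducing.continuous_iff.2
    (hunif.continuous (Frequently.of_forall fun n => he.continuous.comp (hg n))), hunif⟩

theorem leftInverse_of_tendstoUniformly {M E : Type*} [TopologicalSpace M] [MetricSpace E]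
    {e : M → E} (he : IsEmbedding e) {g g' : ℕ → M → M} {G G' : M → M} (hG : Continuous G)
    (hg : TendstoUniformly (fun n => e ∘ g n) (e ∘ G) atTop)
    (hg' : TendstoUniformly (fun n => e ∘ g' n) (e ∘ G') atTop)
    (hinv : ∀ n, Function.LeftInverse (g n) (g' n)) : Function.LeftInverse G G' := by
  intro t
  have ht : Tendsto (fun n => g' n t) atTop (𝓝 (G' t)) :=
    he.isInducing.tendsto_nhds_iff.2 (hg'.tendsto_at t)
  have hcomp : Tendsto (fun n => e (g n (g' n t))) atTop (𝓝 (e (G (G' t)))) :=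
    hg.tendsto_comp (he.continuous.comp hG).continuousAt ht
  simp only [hinv _ t] at hcomp
  exact he.injective (tendsto_nhds_unique hcomp tendsto_const_nhds)

theorem exists_homeomorph_tendsto {M E : Type*} [TopologicalSpace M] [MetricSpace E]
    [CompleteSpace E] {e : M → E} (he : IsClosedEmbedding e) {g : ℕ → M ≃ₜ M} {b : ℕ → ℝ}
    (hb : Summable b) (h : ∀ n t, dist (e (g n t)) (e (g (n + 1) t)) ≤ b n)
    (hsymm : ∀ n t, dist (e ((g n).symm t)) (e ((g (n + 1)).symm t)) ≤ b n) :
    ∃ G : M ≃ₜ M, (∀ t, Tendsto (fun n => g n t) atTop (𝓝 (G t))) ∧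
      ∀ t, Tendsto (fun n => (g n).symm t) atTop (𝓝 (G.symm t)) := by
  obtain ⟨G, hG, hgG⟩ := exists_continuous_tendstoUniformly he (fun n => (g n).continuous) hb h
  obtain ⟨G', hG', hgG'⟩ :=
    exists_continuous_tendstoUniformly he (fun n => (g n).symm.continuous) hb hsymm
  exact ⟨{ toFun := G
           invFun := G'
           left_inv := leftInverse_of_tendstoUniformly he.isEmbedding hG' hgG' hgG
             fun n => (g n).symm_apply_apply
           right_inv := leftInverse_of_tendstoUniformly he.isEmbedding hG hgG hgG'
             fun n => (g n).apply_symm_apply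
           continuous_toFun := hG
           continuous_invFun := hG' },
    fun t => he.isInducing.tendsto_nhds_iff.2 (hgG.tendsto_at t),
    fun t => he.isInducing.tendsto_nhds_iff.2 (hgG'.tendsto_at t)⟩

namespace NormData

variable {d : ℕ} {M : Type v} [TopologicalSpace M] [ChartedSpace (EuclideanSpace ℝ (Fin d)) M]
  {k : ℕ} {α : ℝ}

theorem DiffBound.exists_tendsto [CompactSpace M] {D : NormData d M} {g : ℕ → M ≃ₜ M} {b : ℕ → ℝ}
    (hg : ∀ n, D.DiffBound k α (g (n + 1)) (g n) (b n)) (hb : Summable b) :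
    ∃ G : M ≃ₜ M, (∀ t, Tendsto (fun n => g n t) atTop (𝓝 (G t))) ∧
      ∀ t, Tendsto (fun n => (g n).symm t) atTop (𝓝 (G.symm t)) := by
  refine exists_homeomorph_tendsto D.isClosedEmbedding_emb hb (fun n t => ?_) fun n t => ?_ <;>
    rw [dist_comm, dist_eq_norm]
  · exact (hg n).map.norm_apply_le t
  · exact (hg n).symm.norm_apply_le t

theorem exists_diffBound_of_tendsto [IsManifold (𝓡 d) ∞ M] [CompactSpace M] (D : NormData d M)
    (hk : 1 ≤ k) (hα : 0 ≤ α) (hα' : α ≤ 1) :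
    ∃ C : ℝ, ∀ (g : ℕ → M ≃ₜ M) (G : M ≃ₜ M) (b : ℕ → ℝ),
      (∀ n, D.DiffBound k α (g (n + 1)) (g n) (b n)) → Summable b →
      (∀ t, Tendsto (fun n => g n t) atTop (𝓝 (G t))) →
      (∀ t, Tendsto (fun n => (g n).symm t) atTop (𝓝 (G.symm t))) →
      ∀ n, D.DiffBound k α G (g n) (C * ∑' m, b (m + n)) := by
  obtain ⟨C, hC⟩ := D.exists_mapBound_sub_of_tendsto (EuclideanSpace ℝ (Fin D.dim)) hk hα hα'
  have hemb := D.emb_smooth.continuous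
  exact ⟨C, fun g G b hg hb hG hG' n =>
    ⟨hC (fun n t => D.emb (g n t)) (fun t => D.emb (G t)) b (fun n => (hg n).map) hb
        (fun t => (hemb.tendsto _).comp (hG t)) n,
      hC (fun n t => D.emb ((g n).symm t)) (fun t => D.emb (G.symm t)) b (fun n => (hg n).symm) hb
        (fun t => (hemb.tendsto _).comp (hG' t)) n⟩⟩

end NormData

theorem mul_rpow_rpow {a b s t : ℝ} (ha : 0 ≤ a) (hb : 0 ≤ b) :
    (a * b ^ s) ^ t = a ^ t * b ^ (s * t) := by
  rw [Real.mul_rpow ha (by positivity), ← Real.rpow_mul hb]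

theorem pow_mul_rpow_mul_pow {a b s : ℝ} (ha : 0 ≤ a) (hb : 0 < b) (n : ℕ) :
    b ^ n * (a * b ^ n) ^ s = a ^ s * (b ^ (s + 1)) ^ n := by
  rw [Real.mul_rpow ha (by positivity), ← Real.rpow_pow_comm hb.le, Real.rpow_add_one hb.ne',
    mul_pow]
  ring

/-! ## Cocycles with controlled iterates -/

section Iterates

variable {X : Type u} {M : Type v} [TopologicalSpace M] (f : X → X) (A : X → M ≃ₜ M)

theorem cocycleIter_add (m n : ℕ) (x : X) :
    cocycleIter f A (m + n) x = cocycleIter f A m (f^[n] x) * cocycleIter f A n x := by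
  induction m with
  | zero => rw [Nat.zero_add, cocycleIter, one_mul]
  | succ m ih =>
    rw [Nat.succ_add, cocycleIter, ih, cocycleIter, Function.iterate_add_apply, mul_assoc]

/-- The maps `(A^n_y)⁻¹ ∘ A^n_x`, whose limit is the holonomy from `x` to `y`. -/
def approxHolonomy (n : ℕ) (x y : X) : M ≃ₜ M := (cocycleIter f A n y)⁻¹ * cocycleIter f A n x

theorem approxHolonomy_zero (x y : X) : approxHolonomy f A 0 x y = 1 := by
  simp only [approxHolonomy, cocycleIter, inv_mul_cancel]

theorem approxHolonomy_self (n : ℕ) (x : X) : approxHolonomy f A n x x = 1 := by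
  simp only [approxHolonomy, inv_mul_cancel]

theorem approxHolonomy_trans (n : ℕ) (x y z : X) :
    approxHolonomy f A n y z * approxHolonomy f A n x y = approxHolonomy f A n x z := by
  simp only [approxHolonomy]
  group

theorem approxHolonomy_add (m n : ℕ) (x y : X) :
    approxHolonomy f A (m + n) x y = (cocycleIter f A n y)⁻¹ *
      approxHolonomy f A m (f^[n] x) (f^[n] y) * cocycleIter f A n x := by
  simp only [approxHolonomy, cocycleIter_add f A m n]
  group

variable {f A}

theorem contMDiff_cocycleIter {d k : ℕ} [ChartedSpace (EuclideanSpace ℝ (Fin d)) M]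
    (hA : ∀ x, ContMDiff (𝓡 d) (𝓡 d) k (A x)) (n : ℕ) (x : X) :
    ContMDiff (𝓡 d) (𝓡 d) k (cocycleIter f A n x) := by
  induction n with
  | zero => exact contMDiff_id
  | succ n ih => exact (hA _).comp ih

theorem contMDiff_cocycleIter_symm {d k : ℕ} [ChartedSpace (EuclideanSpace ℝ (Fin d)) M]
    (hA : ∀ x, ContMDiff (𝓡 d) (𝓡 d) k (A x).symm) (n : ℕ) (x : X) :
    ContMDiff (𝓡 d) (𝓡 d) k (cocycleIter f A n x).symm := by
  induction n with
  | zero => exact contMDiff_id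
  | succ n ih => exact ih.comp (hA _)

end Iterates

/-- A cocycle whose generator is `β`-Hölder in the `C^{k+γ}` topology and whose iterates grow in
`C^{k+γ}` at most like `η ^ n`. The case `n = 0` of `iter` bounds the identity. -/
structure CocycleBound {X : Type u} [MetricSpace X] {d : ℕ} {M : Type v} [TopologicalSpace M]
    [ChartedSpace (EuclideanSpace ℝ (Fin d)) M] (D : NormData d M) (k : ℕ) (γ : ℝ) (f : X → X)
    (A : X → M ≃ₜ M) (β c L η : ℝ) : Prop where
  one_le_const : 1 ≤ L
  one_le_rate : 1 ≤ η
  holderConst_nonneg : 0 ≤ c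
  iter : ∀ n x, D.SizeBound k γ (cocycleIter f A n x) (L * η ^ n)
  holder : ∀ x y, D.DiffBound k γ (A x) (A y) (c * dist x y ^ β)

section CocycleBound

variable {X : Type u} {d : ℕ} {M : Type v} [TopologicalSpace M]
  [ChartedSpace (EuclideanSpace ℝ (Fin d)) M] {D : NormData d M} {k : ℕ} {α β γ η : ℝ}
  {f : X → X} {A : X → M ≃ₜ M}

theorem exists_sizeBound_cocycleIter [IsManifold (𝓡 d) ∞ M]
    (hγ : 0 ≤ γ) (hγ' : γ ≤ 1) (hA : ∀ x, D.MemDiff k γ (A x)) {K : ℝ} (hη : 0 ≤ η)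
    (hK : ∀ x, ∀ n : ℕ, 1 ≤ n → D.size k γ (cocycleIter f A n x) ≤ ENNReal.ofReal (K * η ^ n)) :
    ∃ L : ℝ, 1 ≤ L ∧ ∀ n x, D.SizeBound k γ (cocycleIter f A n x) (L * max η 1 ^ n) := by
  obtain ⟨B, hB⟩ := D.exists_mapBound_emb k hγ hγ'
  have hB0 := hB.nonneg
  refine ⟨2 * (B + |K|) + 1, by linarith [abs_nonneg K], fun n x => ?_⟩
  have hrate : 1 ≤ max η 1 ^ n := one_le_pow₀ (le_max_right _ _)
  rcases Nat.eq_zero_or_pos n with rfl | hn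
  · have hBL : B ≤ (2 * (B + |K|) + 1) * max η 1 ^ 0 := by
      rw [pow_zero, mul_one]
      linarith [abs_nonneg K]
    exact ⟨hB.mono hBL, hB.mono hBL⟩
  · have hsize : D.size k γ (cocycleIter f A n x) ≤ ENNReal.ofReal (|K| * max η 1 ^ n) :=
      (hK x n hn).trans (ENNReal.ofReal_le_ofReal (mul_le_mul (le_abs_self K)
        (pow_le_pow_left₀ hη (le_max_left _ _) n) (by positivity) (abs_nonneg K)))
    have hbound := NormData.SizeBound.of_size_le
      (contMDiff_cocycleIter (fun x => (hA x).contMDiff) n x)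
      (contMDiff_cocycleIter_symm (fun x => (hA x).contMDiff_symm) n x) hB (by positivity) hsize
    exact hbound.mono (by nlinarith)

variable [MetricSpace X]

theorem exists_cocycleBound [IsManifold (𝓡 d) ∞ M]
    (hγ : 0 ≤ γ) (hγ' : γ ≤ 1) (hA : ∀ x, D.MemDiff k γ (A x)) {c : ℝ}
    (hc : ∀ x y, D.diffDist k γ (A x) (A y) ≤ ENNReal.ofReal (c * dist x y ^ β)) {K : ℝ}
    (hη : 0 ≤ η)
    (hK : ∀ x, ∀ n : ℕ, 1 ≤ n → D.size k γ (cocycleIter f A n x) ≤ ENNReal.ofReal (K * η ^ n)) :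
    ∃ c' L, CocycleBound D k γ f A β c' L (max η 1) := by
  obtain ⟨L, hL, hiter⟩ := exists_sizeBound_cocycleIter hγ hγ' hA hη hK
  refine ⟨2 * |c|, L, hL, le_max_right _ _, by positivity, hiter, fun x y => ?_⟩
  rw [mul_assoc]
  refine .of_diffDist_le (hA x) (hA y) (by positivity)
    ((hc x y).trans (ENNReal.ofReal_le_ofReal ?_))
  exact mul_le_mul_of_nonneg_right (le_abs_self c) (by positivity)

namespace CocycleBound

variable {c L : ℝ}

theorem generator (h : CocycleBound D k γ f A β c L η) (x : X) :
    D.SizeBound k γ (A x) (L * η) := by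
  rw [← pow_one η]
  exact h.iter 1 x

theorem mapBound_emb (h : CocycleBound D k γ f A β c L η) (x : X) : D.MapBound k γ D.emb L := by
  rw [← mul_one L, ← pow_zero η]
  exact (h.iter 0 x).map

theorem exists_mapBound_gap [IsManifold (𝓡 d) ∞ M] [CompactSpace M] (hk : 1 ≤ k) (hγ : 0 ≤ γ)
    (hγ' : γ ≤ 1) (h : CocycleBound D k γ f A β c L η) :
    ∃ C Λ : ℝ, 0 ≤ C ∧ 1 ≤ Λ ∧ ∀ x y,
      D.MapBound k γ (fun t => D.emb ((A y).symm (A x t)) - D.emb t) (C * dist x y ^ β) ∧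
      D.MapBound k γ (D.emb ∘ fun t => (A y).symm (A x t)) Λ := by
  obtain ⟨C, hC⟩ := D.exists_mapBound_comp (EuclideanSpace ℝ (Fin D.dim)) hk hγ hγ'
  have ha : 1 ≤ L * η := one_le_mul_of_one_le_of_one_le h.one_le_const h.one_le_rate
  have hc := h.holderConst_nonneg
  refine ⟨|C| * c * (L * η) ^ (k + γ), max 1 (C * (L * η * (L * η) ^ (k + γ))), by positivity,
    le_max_left _ _, fun x y => ⟨?_, ?_⟩⟩
  · have hgap := hC _ (A x) _ _ ha (h.holder y x).symm (h.generator x).map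
    simp only [Function.comp_def, Homeomorph.symm_apply_apply] at hgap
    refine hgap.mono ?_
    calc C * (c * dist y x ^ β * (L * η) ^ (k + γ))
        ≤ |C| * (c * dist y x ^ β * (L * η) ^ (k + γ)) := by gcongr; exact le_abs_self C
      _ = |C| * c * (L * η) ^ (k + γ) * dist x y ^ β := by rw [dist_comm]; ring
  · exact (hC _ (A x) _ _ ha (h.generator y).symm (h.generator x).map).mono (le_max_right _ _)

theorem exists_mapBound_step [IsManifold (𝓡 d) ∞ M] [CompactSpace M] (hk : 1 ≤ k) (hα : 0 ≤ α)
    (hαγ : α < γ) (hγ' : γ ≤ 1) (h : CocycleBound D k γ f A β c L η) :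
    ∃ C : ℝ, 0 ≤ C ∧ ∀ n x y, D.MapBound k α
      (fun t => D.emb (approxHolonomy f A (n + 1) x y t) - D.emb (approxHolonomy f A n x y t))
      (C * (η ^ (k + α + 1)) ^ n * dist (f^[n] x) (f^[n] y) ^ (β * (γ - α))) := by
  have hγ : 0 < γ := hα.trans_lt hαγ
  obtain ⟨e, Λ, he, hΛ, hgap⟩ := h.exists_mapBound_gap hk hγ.le hγ'
  obtain ⟨C₁, hC₁⟩ := D.exists_mapBound_comp_sub_comp (EuclideanSpace ℝ (Fin D.dim)) hk hα hαγ.le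
    hγ hγ'
  obtain ⟨C₂, hC₂⟩ := D.exists_mapBound_comp (EuclideanSpace ℝ (Fin D.dim)) hk hα
    (hαγ.le.trans hγ')
  have hL := h.one_le_const
  have hη := h.one_le_rate
  refine ⟨|C₂ * C₁| * (L * max L Λ ^ (k + γ)) * (2 * e) ^ (γ - α) * (2 * L) ^ (k + α),
    by positivity,
    fun n x y => ?_⟩
  obtain ⟨hΔid, hΔ⟩ := hgap (f^[n] x) (f^[n] y)
  have hsize : 1 ≤ L * η ^ n := one_le_mul_of_one_le_of_one_le hL (one_le_pow₀ hη)
  have houter := hC₁ (D.emb ∘ (cocycleIter f A n y).symm)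
    (fun t => (A (f^[n] y)).symm (A (f^[n] x) t)) id _ (max L Λ) _ (le_max_of_le_right hΛ)
    (h.iter n y).symm (hΔ.mono (le_max_right _ _))
    ((h.mapBound_emb x).mono (le_max_left _ _)) hΔid.to_zero
  have hstep := hC₂ _ (cocycleIter f A n x) _ _ (by linarith) houter
    ((h.iter n x).map.of_exponent_le hγ hα hαγ.le)
  refine NormData.MapBound.mono hstep ?_
  set δ := dist (f^[n] x) (f^[n] y)
  have hdist : (2 * (e * δ ^ β)) ^ (γ - α) = (2 * e) ^ (γ - α) * δ ^ (β * (γ - α)) := by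
    rw [← mul_assoc, mul_rpow_rpow (by positivity) dist_nonneg]
  have hrate : η ^ n * (2 * (L * η ^ n)) ^ (k + α) =
      (2 * L) ^ (k + α) * (η ^ (k + α + 1)) ^ n := by
    rw [← mul_assoc, pow_mul_rpow_mul_pow (by positivity) (by positivity)]
  calc C₂ * (C₁ * (L * η ^ n * max L Λ ^ (k + γ) * (2 * (e * δ ^ β)) ^ (γ - α)) *
        (2 * (L * η ^ n)) ^ (k + α))
      = C₂ * C₁ * (L * max L Λ ^ (k + γ) * (2 * (e * δ ^ β)) ^ (γ - α) *
        (η ^ n * (2 * (L * η ^ n)) ^ (k + α))) := by ring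
    _ ≤ |C₂ * C₁| * (L * max L Λ ^ (k + γ) * (2 * (e * δ ^ β)) ^ (γ - α) *
        (η ^ n * (2 * (L * η ^ n)) ^ (k + α))) := by gcongr; exact le_abs_self _
    _ = |C₂ * C₁| * (L * max L Λ ^ (k + γ)) * (2 * e) ^ (γ - α) * (2 * L) ^ (k + α) *
        (η ^ (k + α + 1)) ^ n * δ ^ (β * (γ - α)) := by rw [hdist, hrate]; ring

theorem exists_diffBound_step [IsManifold (𝓡 d) ∞ M] [CompactSpace M] (hk : 1 ≤ k) (hα : 0 ≤ α)
    (hαγ : α < γ) (hγ' : γ ≤ 1) (h : CocycleBound D k γ f A β c L η) :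
    ∃ C : ℝ, 0 ≤ C ∧ ∀ n x y, D.DiffBound k α (approxHolonomy f A (n + 1) x y)
      (approxHolonomy f A n x y)
      (C * (η ^ (k + α + 1)) ^ n * dist (f^[n] x) (f^[n] y) ^ (β * (γ - α))) := by
  obtain ⟨C, hC, hstep⟩ := h.exists_mapBound_step hk hα hαγ hγ'
  refine ⟨C, hC, fun n x y => ⟨hstep n x y, ?_⟩⟩
  rw [dist_comm]
  exact hstep n y x

end CocycleBound

end CocycleBound

/-! ## Holonomies along exponentially asymptotic orbits -/

/-- The orbits of `x` and `y` approach each other at the rate `lam`, with constant `C₀`. -/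
structure ExpAsymptotic {X : Type u} [MetricSpace X] (f : X → X) (lam C₀ : ℝ) (x y : X) :
    Prop where
  nonneg : 0 ≤ C₀
  dist_le : ∀ n : ℕ, dist (f^[n] x) (f^[n] y) ≤ C₀ * lam ^ n

namespace ExpAsymptotic

variable {X : Type u} [MetricSpace X] {f : X → X} {lam C₀ C₁ : ℝ} {x y z : X}

theorem refl (f : X → X) (lam : ℝ) (x : X) : ExpAsymptotic f lam 0 x x :=
  ⟨le_rfl, fun n => by rw [dist_self, zero_mul]⟩

theorem symm (h : ExpAsymptotic f lam C₀ x y) : ExpAsymptotic f lam C₀ y x :=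
  ⟨h.nonneg, fun n => by rw [dist_comm]; exact h.dist_le n⟩

theorem trans (h : ExpAsymptotic f lam C₀ x y) (h' : ExpAsymptotic f lam C₁ y z) :
    ExpAsymptotic f lam (C₀ + C₁) x z :=
  ⟨add_nonneg h.nonneg h'.nonneg, fun n => (dist_triangle _ _ _).trans
    ((add_le_add (h.dist_le n) (h'.dist_le n)).trans_eq (add_mul ..).symm)⟩

theorem mono (h : ExpAsymptotic f lam C₀ x y) (hlam : 0 ≤ lam) (hC : C₀ ≤ C₁) :
    ExpAsymptotic f lam C₁ x y :=
  ⟨h.nonneg.trans hC, fun n => (h.dist_le n).trans (by gcongr)⟩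

theorem iterate (h : ExpAsymptotic f lam C₀ x y) (hlam : 0 ≤ lam) (m : ℕ) :
    ExpAsymptotic f lam (C₀ * lam ^ m) (f^[m] x) (f^[m] y) := by
  refine ⟨mul_nonneg h.nonneg (by positivity), fun n => ?_⟩
  rw [← Function.iterate_add_apply, ← Function.iterate_add_apply, mul_assoc, ← pow_add, add_comm m]
  exact h.dist_le (n + m)

end ExpAsymptotic

/-- `H x y` is the `C^{k+α}` limit of the maps `(A^n_y)⁻¹ ∘ A^n_x` for all `x`, `y` whose orbits
approach each other at the rate `lam`; the convergence is exponential, with a constant that depends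
on `x` and `y` only through the constant `C₀` of this approach. -/
def IsHolonomy {X : Type u} [MetricSpace X] {d : ℕ} {M : Type v} [TopologicalSpace M]
    [ChartedSpace (EuclideanSpace ℝ (Fin d)) M] (D : NormData d M) (k : ℕ) (α : ℝ) (f : X → X)
    (A : X → M ≃ₜ M) (lam C τ θ : ℝ) (H : X → X → M ≃ₜ M) : Prop :=
  ∀ x y C₀, ExpAsymptotic f lam C₀ x y → ∀ n,
    D.DiffBound k α (H x y) (approxHolonomy f A n x y) (C * C₀ ^ τ * θ ^ n)

section Existence

variable {X : Type u} [MetricSpace X] {d : ℕ} {M : Type v} [TopologicalSpace M]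
  [ChartedSpace (EuclideanSpace ℝ (Fin d)) M] {D : NormData d M} {k : ℕ} {α β γ η c L lam : ℝ}
  {f : X → X} {A : X → M ≃ₜ M}

theorem exists_isHolonomy_of_step [IsManifold (𝓡 d) ∞ M] [CompactSpace M] (hk : 1 ≤ k)
    (hα : 0 ≤ α) (hα' : α ≤ 1) {C τ θ : ℝ} (hθ : 0 ≤ θ) (hθ' : θ < 1)
    (hstep : ∀ x y C₀, ExpAsymptotic f lam C₀ x y → ∀ n, D.DiffBound k α
      (approxHolonomy f A (n + 1) x y) (approxHolonomy f A n x y) (C * C₀ ^ τ * θ ^ n)) :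
    ∃ (C' : ℝ) (H : X → X → M ≃ₜ M), IsHolonomy D k α f A lam C' τ θ H := by
  have hsummable (C₀ : ℝ) : Summable fun n => C * C₀ ^ τ * θ ^ n :=
    (summable_geometric_of_lt_one hθ hθ').mul_left _
  have hlim (x y : X) : ∃ H : M ≃ₜ M, ∀ C₀, ExpAsymptotic f lam C₀ x y →
      (∀ t, Tendsto (fun n => approxHolonomy f A n x y t) atTop (𝓝 (H t))) ∧
      ∀ t, Tendsto (fun n => (approxHolonomy f A n x y).symm t) atTop (𝓝 (H.symm t)) := by
    by_cases hxy : ∃ C₀, ExpAsymptotic f lam C₀ x y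
    · obtain ⟨C₀, h⟩ := hxy
      obtain ⟨H, hH⟩ := NormData.DiffBound.exists_tendsto
        (g := fun n => approxHolonomy f A n x y) (hstep x y C₀ h) (hsummable C₀)
      exact ⟨H, fun _ _ => hH⟩
    · exact ⟨1, fun C₀ h => absurd ⟨C₀, h⟩ hxy⟩
  choose H hH using hlim
  obtain ⟨C', hC'⟩ := D.exists_diffBound_of_tendsto hk hα hα'
  refine ⟨C' * C * (1 - θ)⁻¹, H, fun x y C₀ h n => ?_⟩
  have htail : C' * ∑' m, C * C₀ ^ τ * θ ^ (m + n) = C' * C * (1 - θ)⁻¹ * C₀ ^ τ * θ ^ n := by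
    rw [tsum_mul_left, ← tsum_geometric_of_lt_one hθ hθ']
    simp only [pow_add, tsum_mul_right]
    ring
  rw [← htail]
  exact hC' (fun n => approxHolonomy f A n x y) _ _ (hstep x y C₀ h) (hsummable C₀)
    (hH x y C₀ h).1 (hH x y C₀ h).2 n

theorem CocycleBound.exists_isHolonomy [IsManifold (𝓡 d) ∞ M] [CompactSpace M] (hk : 1 ≤ k)
    (hα : 0 ≤ α) (hαγ : α < γ) (hγ' : γ ≤ 1) (hβ : 0 ≤ β)
    (h : CocycleBound D k γ f A β c L η) (hlam : 0 ≤ lam)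
    (hθ : η ^ (k + α + 1) * lam ^ (β * (γ - α)) < 1) :
    ∃ (C : ℝ) (H : X → X → M ≃ₜ M), IsHolonomy D k α f A lam C (β * (γ - α))
      (η ^ (k + α + 1) * lam ^ (β * (γ - α))) H := by
  obtain ⟨C, hC, hstep⟩ := h.exists_diffBound_step hk hα hαγ hγ'
  have hη := h.one_le_rate
  have hτ : 0 ≤ β * (γ - α) := mul_nonneg hβ (sub_nonneg.2 hαγ.le)
  refine exists_isHolonomy_of_step (C := C) hk hα (hαγ.le.trans hγ') (by positivity) hθ
    fun x y C₀ hxy n => (hstep n x y).mono ?_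
  have hC₀ := hxy.nonneg
  calc C * (η ^ (k + α + 1)) ^ n * dist (f^[n] x) (f^[n] y) ^ (β * (γ - α))
      ≤ C * (η ^ (k + α + 1)) ^ n * (C₀ * lam ^ n) ^ (β * (γ - α)) := by
        exact mul_le_mul_of_nonneg_left (Real.rpow_le_rpow dist_nonneg (hxy.dist_le n) hτ)
          (by positivity)
    _ = C * C₀ ^ (β * (γ - α)) * (η ^ (k + α + 1) * lam ^ (β * (γ - α))) ^ n := by
        rw [Real.mul_rpow hC₀ (by positivity), ← Real.rpow_pow_comm hlam, mul_pow]
        ring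

end Existence

section Continuity

variable {X : Type u} [MetricSpace X] {d : ℕ} {M : Type v} [TopologicalSpace M]
  [ChartedSpace (EuclideanSpace ℝ (Fin d)) M] [IsManifold (𝓡 d) ∞ M] [CompactSpace M]
  {D : NormData d M} {k : ℕ} {α β γ η c L : ℝ} {f : X → X} {A : X → M ≃ₜ M}

namespace CocycleBound

omit [IsManifold (𝓡 d) ∞ M] [CompactSpace M] in
theorem tendstoDiff_generator (hα : 0 ≤ α) (hαγ : α < γ) (hβ : 0 < β)
    (h : CocycleBound D k γ f A β c L η) (x : X) : D.TendstoDiff k α A (𝓝 x) (A x) := by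
  refine .of_tendsto_zero (b := fun y => 2 * (c * dist y x ^ β))
    (fun y => (h.holder y x).of_exponent_le (hα.trans_lt hαγ) hα hαγ.le) ?_
  have hdist : Tendsto (fun y => dist y x) (𝓝 x) (𝓝 0) := tendsto_iff_dist_tendsto_zero.1 tendsto_id
  simpa [Real.zero_rpow hβ.ne'] using
    ((hdist.rpow_const (Or.inr hβ.le)).const_mul c).const_mul 2

theorem tendstoDiff_cocycleIter (hk : 1 ≤ k) (hα : 0 ≤ α) (hαγ : α < γ) (hγ' : γ ≤ 1) (hβ : 0 < β)
    (h : CocycleBound D k γ f A β c L η) (hf : Continuous f) (n : ℕ) (x : X) :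
    D.TendstoDiff k α (cocycleIter f A n) (𝓝 x) (cocycleIter f A n x) := by
  induction n with
  | zero => exact .const D k α (𝓝 x) 1
  | succ n ih =>
    exact ((h.tendstoDiff_generator hα hαγ hβ (f^[n] x)).comp_tendsto
      ((hf.iterate n).tendsto x)).mul ih hk hα hαγ hγ' (fun _ => h.generator _) (h.generator _)
      (h.iter n) (h.iter n x)

theorem tendstoDiff_approxHolonomy (hk : 1 ≤ k) (hα : 0 ≤ α) (hαγ : α < γ) (hγ' : γ ≤ 1)
    (hβ : 0 < β) (h : CocycleBound D k γ f A β c L η) (hf : Continuous f) (n : ℕ) (x y : X) :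
    D.TendstoDiff k α (fun p : X × X => approxHolonomy f A n p.1 p.2) (𝓝 (x, y))
      (approxHolonomy f A n x y) :=
  ((h.tendstoDiff_cocycleIter hk hα hαγ hγ' hβ hf n y).comp_tendsto
    (continuous_snd.tendsto (x, y))).inv.mul
    ((h.tendstoDiff_cocycleIter hk hα hαγ hγ' hβ hf n x).comp_tendsto
      (continuous_fst.tendsto (x, y))) hk hα hαγ hγ' (fun p => (h.iter n p.2).inv) (h.iter n y).inv
    (fun p => h.iter n p.1) (h.iter n x)

end CocycleBound

end Continuity

namespace IsHolonomy

variable {X : Type u} [MetricSpace X] {d : ℕ} {M : Type v} [TopologicalSpace M]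
  [ChartedSpace (EuclideanSpace ℝ (Fin d)) M] {D : NormData d M} {k : ℕ} {α : ℝ}
  {f : X → X} {A : X → M ≃ₜ M} {lam C τ θ C₀ C₁ : ℝ} {H : X → X → M ≃ₜ M} {x y z : X}

theorem tendstoDiff (h : IsHolonomy D k α f A lam C τ θ H) (hθ : 0 ≤ θ) (hθ' : θ < 1)
    (hxy : ExpAsymptotic f lam C₀ x y) :
    D.TendstoDiff k α (fun n => approxHolonomy f A n x y) atTop (H x y) := by
  refine .of_tendsto_zero (fun n => (h x y C₀ hxy n).comm) ?_
  simpa using (tendsto_pow_atTop_nhds_zero_of_lt_one hθ hθ').const_mul (C * C₀ ^ τ)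

theorem tendsto_emb_apply (h : IsHolonomy D k α f A lam C τ θ H) (hθ : 0 ≤ θ) (hθ' : θ < 1)
    (hxy : ExpAsymptotic f lam C₀ x y) {s : ℕ → M} {t : M} (hs : Tendsto s atTop (𝓝 t)) :
    Tendsto (fun n => D.emb (approxHolonomy f A n x y (s n))) atTop (𝓝 (D.emb (H x y t))) := by
  have hrate : Tendsto (fun n => C * C₀ ^ τ * θ ^ n) atTop (𝓝 0) := by
    simpa using (tendsto_pow_atTop_nhds_zero_of_lt_one hθ hθ').const_mul (C * C₀ ^ τ)
  have hH : Tendsto (fun n => D.emb (H x y (s n))) atTop (𝓝 (D.emb (H x y t))) :=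
    ((D.emb_smooth.continuous.comp (H x y).continuous).tendsto t).comp hs
  have hgap : Tendsto (fun n => D.emb (H x y (s n)) - D.emb (approxHolonomy f A n x y (s n)))
      atTop (𝓝 0) :=
    squeeze_zero_norm (fun n => (h x y C₀ hxy n).map.norm_apply_le (s n)) hrate
  simpa using hH.sub hgap

theorem tendsto_apply [CompactSpace M] (h : IsHolonomy D k α f A lam C τ θ H)
    (hθ : 0 ≤ θ) (hθ' : θ < 1) (hxy : ExpAsymptotic f lam C₀ x y) (t : M) :
    Tendsto (fun n => approxHolonomy f A n x y t) atTop (𝓝 (H x y t)) :=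
  D.isClosedEmbedding_emb.isInducing.tendsto_nhds_iff.2
    (h.tendsto_emb_apply hθ hθ' hxy tendsto_const_nhds)

theorem self (h : IsHolonomy D k α f A lam C τ θ H) (hθ : 0 ≤ θ) (hθ' : θ < 1) (x : X) :
    H x x = 1 := by
  ext t
  refine D.emb_injective (tendsto_nhds_unique
    (h.tendsto_emb_apply hθ hθ' (.refl f lam x) tendsto_const_nhds) ?_)
  simp only [approxHolonomy_self]
  exact tendsto_const_nhds

theorem trans [CompactSpace M] (h : IsHolonomy D k α f A lam C τ θ H) (hθ : 0 ≤ θ) (hθ' : θ < 1)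
    (hxy : ExpAsymptotic f lam C₀ x y) (hyz : ExpAsymptotic f lam C₁ y z) :
    H y z * H x y = H x z := by
  ext t
  refine D.emb_injective (tendsto_nhds_unique
    (h.tendsto_emb_apply hθ hθ' hyz (h.tendsto_apply hθ hθ' hxy t)) ?_)
  refine (h.tendsto_emb_apply hθ hθ' (hxy.trans hyz) tendsto_const_nhds).congr fun n => ?_
  rw [← approxHolonomy_trans f A n x y z, Homeomorph.mul_apply]

theorem inv [CompactSpace M] (h : IsHolonomy D k α f A lam C τ θ H) (hθ : 0 ≤ θ) (hθ' : θ < 1)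
    (hxy : ExpAsymptotic f lam C₀ x y) : (H x y)⁻¹ = H y x :=
  inv_eq_of_mul_eq_one_left (by rw [h.trans hθ hθ' hxy hxy.symm, h.self hθ hθ'])

theorem invariance [CompactSpace M] (h : IsHolonomy D k α f A lam C τ θ H) (hθ : 0 ≤ θ)
    (hθ' : θ < 1) (hlam : 0 ≤ lam) (hxy : ExpAsymptotic f lam C₀ x y) (n : ℕ) :
    H x y = (cocycleIter f A n y)⁻¹ * H (f^[n] x) (f^[n] y) * cocycleIter f A n x := by
  ext t
  refine D.emb_injective (tendsto_nhds_unique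
    ((h.tendsto_emb_apply hθ hθ' hxy tendsto_const_nhds).comp (tendsto_add_atTop_nat n)) ?_)
  have hshift := ((D.emb_smooth.continuous.comp (cocycleIter f A n y)⁻¹.continuous).tendsto _).comp
    (h.tendsto_apply hθ hθ' (hxy.iterate hlam n) (cocycleIter f A n x t))
  refine hshift.congr fun m => ?_
  simp only [Function.comp_apply, approxHolonomy_add, Homeomorph.mul_apply]

theorem diffBound_one (h : IsHolonomy D k α f A lam C τ θ H) (hxy : ExpAsymptotic f lam C₀ x y) :
    D.DiffBound k α (H x y) 1 (C * C₀ ^ τ) := by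
  simpa only [pow_zero, mul_one, approxHolonomy_zero] using h x y C₀ hxy 0

theorem memDiff [IsManifold (𝓡 d) ∞ M] [CompactSpace M] (h : IsHolonomy D k α f A lam C τ θ H)
    (hk : k ≠ 0) (hα : 0 ≤ α) (hα' : α ≤ 1) (hxy : ExpAsymptotic f lam C₀ x y) :
    D.MemDiff k α (H x y) := by
  obtain ⟨B, hB⟩ := D.exists_mapBound_emb k hα hα'
  exact ((h.diffBound_one hxy).sizeBound ⟨hB, hB⟩).memDiff hk

/-- Near a pair in `W`, the holonomies are uniformly close to `approxHolonomy f A n`, which is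
continuous. -/
theorem tendstoDiff_nhdsWithin (h : IsHolonomy D k α f A lam C τ θ H) (hθ : 0 ≤ θ) (hθ' : θ < 1)
    {W : Set (X × X)} (hW : ∀ p ∈ W, ExpAsymptotic f lam C₀ p.1 p.2) (hxy : (x, y) ∈ W)
    (happrox : ∀ n, D.TendstoDiff k α (fun p : X × X => approxHolonomy f A n p.1 p.2) (𝓝[W] (x, y))
      (approxHolonomy f A n x y)) :
    D.TendstoDiff k α (fun p : X × X => H p.1 p.2) (𝓝[W] (x, y)) (H x y) := by
  intro ε hε
  have hrate : Tendsto (fun n => C * C₀ ^ τ * θ ^ n) atTop (𝓝 0) := by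
    simpa using (tendsto_pow_atTop_nhds_zero_of_lt_one hθ hθ').const_mul (C * C₀ ^ τ)
  obtain ⟨n, hn⟩ := (hrate.eventually_lt_const (by positivity : 0 < ε / 3)).exists
  filter_upwards [self_mem_nhdsWithin, happrox n (ε / 3) (by positivity)] with p hp hpn
  exact (((h _ _ C₀ (hW p hp) n).trans hpn).trans (h x y C₀ (hW _ hxy) n).comm).mono (by linarith)

end IsHolonomy

/-! ## Stable leaves of the base systems -/

theorem ExpAsymptotic.exists_of_iterate {X : Type u} [MetricSpace X] {f : X → X} {lam : ℝ}
    (hlam : 0 < lam) {x y : X} {n : ℕ} (h : ∃ C₀, ExpAsymptotic f lam C₀ (f^[n] x) (f^[n] y)) :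
    ∃ C₀, ExpAsymptotic f lam C₀ x y := by
  induction n generalizing x y with
  | zero => exact h
  | succ n ih =>
    obtain ⟨C₀, h₁⟩ := ih (x := f x) (y := f y) h
    refine ⟨max (dist x y) (C₀ / lam), le_max_of_le_left dist_nonneg, fun m => ?_⟩
    cases m with
    | zero => simpa only [Function.iterate_zero_apply, pow_zero, mul_one] using le_max_left _ _
    | succ m =>
      calc dist (f^[m] (f x)) (f^[m] (f y)) ≤ C₀ * lam ^ m := h₁.dist_le m
        _ = C₀ / lam * lam ^ (m + 1) := by rw [pow_succ']; field_simp
        _ ≤ max (dist x y) (C₀ / lam) * lam ^ (m + 1) := by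
          gcongr
          exact le_max_right _ _

theorem ContractsLocally.expAsymptotic {X : Type u} [MetricSpace X] {f : X → X} {lam : ℝ}
    {Wloc : X → Set X} (h : ContractsLocally f lam Wloc) {x y : X} (hy : y ∈ Wloc x) :
    ExpAsymptotic f lam (dist x y) x y :=
  ⟨dist_nonneg, fun n => (h x y hy n).trans_eq (mul_comm _ _)⟩

section PathLength

variable {E : Type*} [NormedAddCommGroup E] [NormedSpace ℝ E] {B : Type*} [TopologicalSpace B]
  {I : ModelWithCorners ℝ E B} {N : Type*} [TopologicalSpace N] [ChartedSpace B N]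

theorem continuousOn_norm_mfderivWithin_Icc [IsManifold I 1 N]
    [RiemannianBundle (fun x : N => TangentSpace I x)]
    [IsContinuousRiemannianBundle E (fun x : N => TangentSpace I x)] {a b : ℝ} (hab : a < b)
    {γ : ℝ → N} (hγ : ContMDiffOn 𝓘(ℝ, ℝ) I 1 γ (Icc a b)) :
    ContinuousOn (fun t => ‖mfderivWithin 𝓘(ℝ, ℝ) I γ (Icc a b) t (1 : ℝ)‖) (Icc a b) := by
  have htangent : ContinuousOn (tangentMapWithin 𝓘(ℝ, ℝ) I γ (Icc a b))
      (π ℝ (TangentSpace 𝓘(ℝ, ℝ)) ⁻¹' Icc a b) :=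
    hγ.continuousOn_tangentMapWithin le_rfl
      (uniqueMDiffOn_iff_uniqueDiffOn.2 (uniqueDiffOn_Icc hab))
  have hunit : Continuous fun t : ℝ => (⟨t, (1 : ℝ)⟩ : TangentBundle 𝓘(ℝ, ℝ) ℝ) :=
    (tangentBundleModelSpaceHomeomorph 𝓘(ℝ, ℝ)).symm.continuous.comp
      (continuous_id.prodMk continuous_const)
  have hvelocity : ContinuousOn (fun t : ℝ =>
      (⟨γ t, mfderivWithin 𝓘(ℝ, ℝ) I γ (Icc a b) t (1 : ℝ)⟩ : TangentBundle I N)) (Icc a b) :=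
    htangent.comp hunit.continuousOn fun t ht => ht
  simpa only [norm_eq_sqrt_real_inner] using (hvelocity.inner_bundle hvelocity).sqrt

theorem pathELength_lt_top [IsManifold I 1 N]
    [RiemannianBundle (fun x : N => TangentSpace I x)]
    [IsContinuousRiemannianBundle E (fun x : N => TangentSpace I x)] {a b : ℝ} (hab : a < b)
    {γ : ℝ → N} (hγ : ContMDiffOn 𝓘(ℝ, ℝ) I 1 γ (Icc a b)) : pathELength I γ a b < ⊤ := by
  obtain ⟨C, hC⟩ :=
    isCompact_Icc.exists_bound_of_continuousOn (continuousOn_norm_mfderivWithin_Icc hab hγ)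
  rw [pathELength_eq_lintegral_mfderivWithin_Icc]
  refine MeasureTheory.setLIntegral_lt_top_of_le_nnreal (by simp) ⟨C.toNNReal, fun t ht => ?_⟩
  rw [← ofReal_norm]
  exact ENNReal.ofReal_le_ofReal ((le_abs_self _).trans (hC t ht))

theorem mfderivWithin_comp_Icc {f : N → N} (hf : ContMDiff I I 1 f) {a b : ℝ} (hab : a < b)
    {γ : ℝ → N} (hγ : ContMDiffOn 𝓘(ℝ, ℝ) I 1 γ (Icc a b)) {s : ℝ} (hs : s ∈ Icc a b) :
    mfderivWithin 𝓘(ℝ, ℝ) I (f ∘ γ) (Icc a b) s =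
      (mfderiv I I f (γ s)).comp (mfderivWithin 𝓘(ℝ, ℝ) I γ (Icc a b) s) :=
  mfderiv_comp_mfderivWithin s (hf.mdifferentiableAt one_ne_zero)
    (hγ.mdifferentiableOn one_ne_zero s hs)
    (uniqueMDiffOn_iff_uniqueDiffOn.2 (uniqueDiffOn_Icc hab) s hs)

end PathLength
section Leaf

variable {m : ℕ} {X : Type u} [MetricSpace X] [ChartedSpace (EuclideanSpace ℝ (Fin m)) X]
  [RiemannianBundle (fun x : X => TangentSpace (𝓡 m) x)] {f : X ≃ₜ X}
  {Es Ec Eu : ∀ x : X, Submodule ℝ (TangentSpace (𝓡 m) x)} {ls lu xs xu : X → ℝ}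
  {lam ρ : ℝ} {x y : X} {γ : ℝ → X}

theorem isContinuousRiemannianBundle_tangentSpace [IsManifold (𝓡 m) ∞ X]
    [h : IsContMDiffRiemannianBundle (𝓡 m) ∞ (EuclideanSpace ℝ (Fin m))
      (fun x : X => TangentSpace (𝓡 m) x)] :
    IsContinuousRiemannianBundle (EuclideanSpace ℝ (Fin m))
      (fun x : X => TangentSpace (𝓡 m) x) := by
  obtain ⟨g, hg, hg'⟩ := h.exists_contMDiff
  exact ⟨g, hg.continuous, hg'⟩

theorem IsPartiallyHyperbolic.norm_mfderiv_le (h : IsPartiallyHyperbolic f Es Ec Eu ls lu xs xu)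
    (x : X) {w : TangentSpace (𝓡 m) x} (hw : w ∈ Es x) :
    ‖mfderiv (𝓡 m) (𝓡 m) f x w‖ ≤ ls x * ‖w‖ := by
  rcases eq_or_ne w 0 with rfl | hw0
  · simp
  · have hnorm : ‖w‖ ≠ 0 := norm_ne_zero_iff.2 hw0
    have hunit := h.bound_stable x (‖w‖⁻¹ • w) ((Es x).smul_mem _ hw)
      (by rw [norm_smul, norm_inv, norm_norm, inv_mul_cancel₀ hnorm])
    rw [map_smul, norm_smul, norm_inv, norm_norm, inv_mul_eq_div, div_lt_iff₀ (by positivity)]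
      at hunit
    exact hunit.le

namespace IsTangentCurve

theorem comp (h : IsPartiallyHyperbolic f Es Ec Eu ls lu xs xu) (hγ : IsTangentCurve Es x y γ) :
    IsTangentCurve Es (f x) (f y) (f ∘ γ) where
  contMDiffOn := h.contMDiff.comp_contMDiffOn hγ.contMDiffOn
  source := congrArg f hγ.source
  target := congrArg f hγ.target
  tangent s hs := by
    rw [mfderivWithin_comp_Icc h.contMDiff zero_lt_one hγ.contMDiffOn hs]
    change _ ∈ Es (f (γ s))
    rw [← h.map_stable (γ s)]
    exact Submodule.mem_map_of_mem (hγ.tangent s hs)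

theorem pathELength_comp_le (h : IsPartiallyHyperbolic f Es Ec Eu ls lu xs xu)
    (hγ : IsTangentCurve Es x y γ) (hlam : ∀ x, ls x ≤ lam) :
    pathELength (𝓡 m) (f ∘ γ) 0 1 ≤ ENNReal.ofReal lam * pathELength (𝓡 m) γ 0 1 := by
  rw [pathELength_eq_lintegral_mfderivWithin_Icc, pathELength_eq_lintegral_mfderivWithin_Icc,
    ← MeasureTheory.lintegral_const_mul' _ _ ENNReal.ofReal_ne_top]
  refine MeasureTheory.setLIntegral_mono' measurableSet_Icc fun s hs => ?_
  rw [mfderivWithin_comp_Icc h.contMDiff zero_lt_one hγ.contMDiffOn hs]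
  calc _ = ENNReal.ofReal ‖mfderiv (𝓡 m) (𝓡 m) f (γ s)
        (mfderivWithin 𝓘(ℝ, ℝ) (𝓡 m) γ (Icc 0 1) s (1 : ℝ))‖ := (ofReal_norm _).symm
    _ ≤ ENNReal.ofReal (lam * ‖mfderivWithin 𝓘(ℝ, ℝ) (𝓡 m) γ (Icc 0 1) s (1 : ℝ)‖) :=
      ENNReal.ofReal_le_ofReal ((h.norm_mfderiv_le (γ s) (hγ.tangent s hs)).trans
        (mul_le_mul_of_nonneg_right (hlam _) (norm_nonneg _)))
    _ = _ := by
      rw [ENNReal.ofReal_mul ((h.pos_rates x).1.le.trans (hlam x)), ofReal_norm]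
      rfl

theorem exists_iterate (h : IsPartiallyHyperbolic f Es Ec Eu ls lu xs xu)
    (hγ : IsTangentCurve Es x y γ) (hlam : ∀ x, ls x ≤ lam) (n : ℕ) :
    ∃ γ' : ℝ → X, IsTangentCurve Es (f^[n] x) (f^[n] y) γ' ∧
      pathELength (𝓡 m) γ' 0 1 ≤ ENNReal.ofReal lam ^ n * pathELength (𝓡 m) γ 0 1 := by
  induction n with
  | zero => exact ⟨γ, hγ, by rw [pow_zero, one_mul]⟩
  | succ n ih =>
    obtain ⟨γ', hγ', hlength⟩ := ih
    rw [Function.iterate_succ_apply', Function.iterate_succ_apply']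
    refine ⟨_, hγ'.comp h, (hγ'.pathELength_comp_le h hlam).trans ?_⟩
    rw [pow_succ', mul_assoc]
    gcongr

end IsTangentCurve

theorem IsPartiallyHyperbolic.exists_iterate_mem_leafBall [IsManifold (𝓡 m) ∞ X]
    [IsContMDiffRiemannianBundle (𝓡 m) ∞ (EuclideanSpace ℝ (Fin m))
      (fun x : X => TangentSpace (𝓡 m) x)] (h : IsPartiallyHyperbolic f Es Ec Eu ls lu xs xu)
    (hlam : ∀ x, ls x ≤ lam) (hlam' : lam < 1) (hρ : 0 < ρ) (hy : y ∈ leaf Es x) :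
    ∃ n : ℕ, f^[n] y ∈ leafBall Es ρ (f^[n] x) := by
  obtain ⟨γ, hγ⟩ := hy
  have := isContinuousRiemannianBundle_tangentSpace (m := m) (X := X)
  have hfinite : pathELength (𝓡 m) γ 0 1 ≠ ⊤ :=
    (pathELength_lt_top zero_lt_one hγ.contMDiffOn).ne
  have hlim : Tendsto (fun n : ℕ => ENNReal.ofReal lam ^ n * pathELength (𝓡 m) γ 0 1) atTop
      (𝓝 0) := by
    simpa using ENNReal.Tendsto.mul_const (ENNReal.tendsto_pow_atTop_nhds_zero_of_lt_one
      (ENNReal.ofReal_lt_one.2 hlam')) (Or.inr hfinite)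
  obtain ⟨n, hn⟩ := (hlim.eventually_lt_const (ENNReal.ofReal_pos.2 hρ)).exists
  obtain ⟨γ', hγ', hlength⟩ := hγ.exists_iterate h hlam n
  exact ⟨n, γ', hγ', hlength.trans_lt hn⟩

end Leaf

/-- What the holonomies need to know about the base: `f` contracts the sets `Wloc x` at the rate
`lam ∈ (0, 1)`, and the orbits of points of `Ws x` eventually enter them. -/
structure HasContractingLeaves {X : Type u} [MetricSpace X] (f : X → X) (lam : ℝ)
    (Ws Wloc : X → Set X) : Prop where
  rate_pos : 0 < lam
  rate_lt_one : lam < 1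
  contracts : ContractsLocally f lam Wloc
  exists_iterate_mem : ∀ x, ∀ y ∈ Ws x, ∃ n : ℕ, f^[n] y ∈ Wloc (f^[n] x)

section Base

variable {X : Type u} [MetricSpace X] {f : X ≃ₜ X} {lam : ℝ} {Ws Wloc : X → Set X}

theorem HasContractingLeaves.exists_expAsymptotic {f : X → X}
    (h : HasContractingLeaves f lam Ws Wloc) {x y : X} (hy : y ∈ Ws x) :
    ∃ C₀, ExpAsymptotic f lam C₀ x y := by
  obtain ⟨n, hn⟩ := h.exists_iterate_mem x y hy
  exact ExpAsymptotic.exists_of_iterate h.rate_pos ⟨_, h.contracts.expAsymptotic hn⟩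

theorem PartiallyHyperbolicBase.hasContractingLeaves (h : PartiallyHyperbolicBase f lam Ws Wloc) :
    HasContractingLeaves f lam Ws Wloc := by
  obtain ⟨m, _, _, _, _, _, Es, Ec, Eu, ls, lu, xs, xu, ρ, -, -, hph, ⟨⟨x₀, hx₀⟩, hub⟩, rfl, hρ,
    rfl, hcontr⟩ := h
  have hlam : lam < 1 := hx₀ ▸ (hph.rates_lt_one x₀).1
  exact ⟨hx₀ ▸ (hph.pos_rates x₀).1, hlam, hcontr, fun x y hy =>
    hph.exists_iterate_mem_leafBall (fun x => hub (mem_range_self x)) hlam hρ hy⟩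

theorem HyperbolicSetBase.hasContractingLeaves (h : HyperbolicSetBase f lam Ws Wloc) :
    HasContractingLeaves f lam Ws Wloc := by
  obtain ⟨m, N, _, _, _, _, _, _, F, U, ι, Es, Eu, ls, lu, ε, -, hhyp, ⟨⟨x₀, hx₀⟩, -⟩, hWs, hε,
    hWloc, hcontr⟩ := h
  refine ⟨hx₀ ▸ (hhyp.pos_rates x₀).1, hx₀ ▸ (hhyp.rates_lt_one x₀).1, hcontr, fun x y hy => ?_⟩
  rw [hWs] at hy
  obtain ⟨n, hn⟩ := eventually_atTop.1 (hy.eventually_le_const hε)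
  refine ⟨n, (hWloc _).symm ▸ fun i => ?_⟩
  rw [← Function.iterate_add_apply, ← Function.iterate_add_apply]
  exact hn (i + n) (Nat.le_add_left n i)

end Base

section Subshift

theorem coding_iterate {X S : Type*} {f : X → X} {e : X → ℤ → S}
    (hshift : ∀ x i, e (f x) i = e x (i + 1)) (n : ℕ) (x : X) (i : ℤ) :
    e (f^[n] x) i = e x (i + n) := by
  induction n generalizing x with
  | zero => rw [Function.iterate_zero_apply, Nat.cast_zero, add_zero]
  | succ n ih => rw [Function.iterate_succ_apply, ih, hshift, Nat.cast_succ, add_assoc]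

/-- The least `|i|` such that the sequences `a` and `b` differ at `i`; it is the exponent of the
metric of a subshift. -/
def firstDisagreement {S : Type*} (a b : ℤ → S) : ℕ :=
  sInf {n : ℕ | ∃ i : ℤ, i.natAbs = n ∧ a i ≠ b i}

theorem add_firstDisagreement_le {S : Type*} {a b : ℤ → S} (hab : ∀ i ≥ (0 : ℤ), a i = b i) {n : ℕ}
    (hne : (fun i => a (i + n)) ≠ fun i => b (i + n)) :
    n + firstDisagreement a b ≤ firstDisagreement (fun i => a (i + n)) fun i => b (i + n) := by
  obtain ⟨i₀, hi₀⟩ := Function.ne_iff.1 hne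
  refine le_csInf ⟨i₀.natAbs, i₀, rfl, hi₀⟩ ?_
  rintro _ ⟨i, rfl, hi⟩
  have hneg : i + n < 0 := not_le.1 fun hi' => hi (hab _ hi')
  have hle : firstDisagreement a b ≤ (i + n).natAbs := Nat.sInf_le ⟨i + n, rfl, hi⟩
  omega

theorem contractsLocally_of_coding {X : Type u} [MetricSpace X] {S : Type*} {f : X → X} {lam : ℝ}
    {e : X → ℤ → S} (hf : Function.Injective f) (hlam : 0 ≤ lam) (hlam' : lam ≤ 1)
    (he : Function.Injective e) (hshift : ∀ x i, e (f x) i = e x (i + 1))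
    (hdist : ∀ x y, x ≠ y → dist x y = lam ^ firstDisagreement (e x) (e y)) :
    ContractsLocally f lam fun x => {y | ∀ i ≥ (0 : ℤ), e y i = e x i} := by
  intro x y hy n
  rcases eq_or_ne x y with rfl | hxy
  · rw [dist_self, dist_self, mul_zero]
  have hne : f^[n] x ≠ f^[n] y := (hf.iterate n).ne hxy
  have hcode (z : X) : e (f^[n] z) = fun i => e z (i + n) := funext (coding_iterate hshift n z)
  have hcode_ne := he.ne hne
  rw [hdist _ _ hne, hdist _ _ hxy, ← pow_add]
  rw [hcode, hcode] at hcode_ne ⊢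
  exact pow_le_pow_of_le_one hlam hlam' (add_firstDisagreement_le (fun i hi => (hy i hi).symm)
    hcode_ne)

theorem SubshiftBase.hasContractingLeaves {X : Type u} [MetricSpace X] {f : X ≃ₜ X} {lam : ℝ}
    {Ws Wloc : X → Set X} (h : SubshiftBase f lam Ws Wloc) :
    HasContractingLeaves f lam Ws Wloc := by
  obtain ⟨_, _, e, hlam, hlam', he, -, hshift, hdist, hWs, hWloc⟩ := h
  obtain rfl : Wloc = fun x => {y | ∀ i ≥ (0 : ℤ), e y i = e x i} := funext hWloc
  refine ⟨hlam, hlam', contractsLocally_of_coding f.injective hlam.le hlam'.le he hshift hdist,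
    fun x y hy => ?_⟩
  rw [hWs] at hy
  obtain ⟨n, hn⟩ := hy
  refine ⟨n.toNat, fun i hi => ?_⟩
  rw [coding_iterate hshift, coding_iterate hshift]
  exact hn _ (by omega)

end Subshift

theorem IsBaseSystem.hasContractingLeaves {X : Type u} [MetricSpace X] {f : X ≃ₜ X} {lam : ℝ}
    {Ws Wloc : X → Set X} (h : IsBaseSystem f lam Ws Wloc) : HasContractingLeaves f lam Ws Wloc :=
  h.elim (·.hasContractingLeaves) (Or.elim · (·.hasContractingLeaves) (·.hasContractingLeaves))

theorem IsHolonomy.tendstoDiff_of_contractsLocally {X : Type u} [MetricSpace X] {d : ℕ} {M : Type v}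
    [TopologicalSpace M] [ChartedSpace (EuclideanSpace ℝ (Fin d)) M] {D : NormData d M} {k : ℕ}
    {α C τ θ lam : ℝ} {f : X → X} {A : X → M ≃ₜ M} {H : X → X → M ≃ₜ M} {Wloc : X → Set X}
    (h : IsHolonomy D k α f A lam C τ θ H) (hθ : 0 ≤ θ) (hθ' : θ < 1) (hlam : 0 ≤ lam)
    (hcontr : ContractsLocally f lam Wloc) {x y : X} (hy : y ∈ Wloc x)
    (happrox : ∀ n, D.TendstoDiff k α (fun p : X × X => approxHolonomy f A n p.1 p.2) (𝓝 (x, y))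
      (approxHolonomy f A n x y)) :
    D.TendstoDiff k α (fun p : X × X => H p.1 p.2) (𝓝[{p | p.2 ∈ Wloc p.1}] (x, y)) (H x y) := by
  have hnear : {p : X × X | dist p.1 p.2 ≤ dist x y + 1} ∈ 𝓝[{p | p.2 ∈ Wloc p.1}] (x, y) :=
    nhdsWithin_le_nhds <| (continuous_dist.tendsto (x, y)).eventually_le_const
      (lt_add_one (dist x y))
  rw [← nhdsWithin_inter_of_mem' hnear]
  exact h.tendstoDiff_nhdsWithin hθ hθ'
    (fun p hp => (hcontr.expAsymptotic hp.1).mono hlam hp.2) ⟨hy, (lt_add_one (dist x y)).le⟩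
    fun n => (happrox n).comp_tendsto (tendsto_id.mono_left nhdsWithin_le_nhds)

theorem max_one_rpow_mul_rpow_lt_one {η lam p s : ℝ} (hlam : 0 ≤ lam) (hlam' : lam < 1) (hs : 0 < s)
    (h : η ^ p * lam ^ s < 1) : max η 1 ^ p * lam ^ s < 1 := by
  rcases le_total η 1 with hη | hη
  · rw [max_eq_right hη, Real.one_rpow, one_mul]
    exact Real.rpow_lt_one hlam hlam' hs
  · rwa [max_eq_left hη]

theorem rpow_mul_rpow_lt_one_of_le {η lam p p' s : ℝ} (hη : 0 ≤ η) (hlam : 0 ≤ lam)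
    (hlam' : lam < 1) (hs : 0 < s) (hp : 0 ≤ p) (hpp' : p ≤ p') (h : η ^ p' * lam ^ s < 1) :
    η ^ p * lam ^ s < 1 := by
  have hmax : η ^ p ≤ max η 1 ^ p' := (Real.rpow_le_rpow hη (le_max_left η 1) hp).trans
    (Real.rpow_le_rpow_of_exponent_le (le_max_right η 1) hpp')
  exact (mul_le_mul_of_nonneg_right hmax (by positivity)).trans_lt
    (max_one_rpow_mul_rpow_lt_one hlam hlam' hs h)

end

theorem proposition3p3_general
    {X : Type u} [MetricSpace X] {f : X → X} (hf : Continuous f) {lam : ℝ} {Ws Wloc : X → Set X}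
    (hleaves : HasContractingLeaves f lam Ws Wloc)
    {d : ℕ} {M : Type v} [TopologicalSpace M] [CompactSpace M]
    [ChartedSpace (EuclideanSpace ℝ (Fin d)) M] [IsManifold (𝓡 d) ∞ M] (D : NormData d M)
    {k : ℕ} (hk : 1 ≤ k) {α γ β : ℝ} (hα : 0 ≤ α) (hαγ : α < γ) (hγ' : γ ≤ 1) (hβ : 0 < β)
    {A : X → M ≃ₜ M} (hA : ∀ x, D.MemDiff k γ (A x))
    {c : ℝ} (hc : ∀ x y, D.diffDist k γ (A x) (A y) ≤ ENNReal.ofReal (c * dist x y ^ β))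
    {K η : ℝ} (hη : 0 ≤ η) (hbunch : η ^ (k + α + 1) * lam ^ (β * (γ - α)) < 1)
    (hK : ∀ x, ∀ n : ℕ, 1 ≤ n → D.size k γ (cocycleIter f A n x) ≤ ENNReal.ofReal (K * η ^ n)) :
    ∃ H : X → X → (M ≃ₜ M),
      (∀ x, ∀ y ∈ Ws x, D.MemDiff k α (H x y) ∧
        Tendsto (fun n : ℕ => D.diffDist k α
          ((cocycleIter f A n y)⁻¹ * cocycleIter f A n x) (H x y)) atTop (𝓝 0)) ∧
      (∀ x, H x x = 1) ∧
      (∀ x, ∀ y ∈ Ws x, ∀ z ∈ Ws x, H y z * H x y = H x z) ∧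
      (∀ x, ∀ y ∈ Ws x, (H x y)⁻¹ = H y x) ∧
      (∀ x, ∀ y ∈ Ws x, ∀ n : ℕ,
        H x y = (cocycleIter f A n y)⁻¹ * H (f^[n] x) (f^[n] y) * cocycleIter f A n x) ∧
      (∃ c₁ : ℝ, ∀ x, ∀ y ∈ Wloc x,
        D.diffDist k α (H x y) 1 ≤ ENNReal.ofReal (c₁ * dist x y ^ (β * (γ - α)))) ∧
      (∀ x, ∀ y ∈ Wloc x,
        Tendsto (fun p : X × X => D.diffDist k α (H p.1 p.2) (H x y))
          (𝓝[{p : X × X | p.2 ∈ Wloc p.1}] (x, y)) (𝓝 0)) := by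
  have hlam := hleaves.rate_pos.le
  have hasymp {x y} (hy : y ∈ Ws x) := hleaves.exists_expAsymptotic hy
  obtain ⟨c', L, hcocycle⟩ := exists_cocycleBound (hα.trans hαγ.le) hγ' hA hc hη hK
  have hθ' := max_one_rpow_mul_rpow_lt_one hlam hleaves.rate_lt_one
    (mul_pos hβ (sub_pos.2 hαγ)) hbunch
  have hθ : 0 ≤ max η 1 ^ (k + α + 1) * lam ^ (β * (γ - α)) := by positivity
  obtain ⟨C, H, hH⟩ := hcocycle.exists_isHolonomy hk hα hαγ hγ' hβ.le hlam hθ'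
  refine ⟨H, fun x y hy => ?_, hH.self hθ hθ', fun x y hy z hz => ?_, fun x y hy => ?_,
    fun x y hy => ?_, ⟨6 * C, fun x y hy => ?_⟩, fun x y hy => ?_⟩
  · obtain ⟨C₀, hxy⟩ := hasymp hy
    exact ⟨hH.memDiff (by omega) hα (hαγ.le.trans hγ') hxy,
      (hH.tendstoDiff hθ hθ' hxy).tendsto_diffDist⟩
  · obtain ⟨C₀, hxy⟩ := hasymp hy
    obtain ⟨C₁, hxz⟩ := hasymp hz
    exact hH.trans hθ hθ' hxy (hxy.symm.trans hxz)
  · exact (hasymp hy).elim fun C₀ hxy => hH.inv hθ hθ' hxy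
  · exact (hasymp hy).elim fun C₀ hxy => hH.invariance hθ hθ' hlam hxy
  · exact mul_assoc 6 C _ ▸ (hH.diffBound_one (hleaves.contracts.expAsymptotic hy)).diffDist_le
  · exact (hH.tendstoDiff_of_contractsLocally hθ hθ' hlam hleaves.contracts hy fun n =>
      hcocycle.tendstoDiff_approxHolonomy hk hα hαγ hγ' hβ hf n x y).tendsto_diffDist

theorem proposition3p3
    -- the base system
    {X : Type u} [MetricSpace X] [CompactSpace X] (f : X ≃ₜ X) (lam : ℝ) (Ws Wloc : X → Set X)
    (hbase : IsBaseSystem f lam Ws Wloc)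
    -- the fiber
    {d : ℕ} {M : Type v} [TopologicalSpace M] [T2Space M] [CompactSpace M]
    [ChartedSpace (EuclideanSpace ℝ (Fin d)) M] [IsManifold (𝓡 d) ∞ M] (D : NormData d M)
    -- the exponents: `q = k + γ` with `0 < γ ≤ 1`, and `k ≤ r < q`
    (k : ℕ) (hk : 1 ≤ k) (γ q r β : ℝ) (hγ : 0 < γ) (hγ' : γ ≤ 1) (hq : q = k + γ)
    (hkr : (k : ℝ) ≤ r) (hrq : r < q) (hβ : 0 < β) (hβ' : β ≤ 1)
    -- the `β`-Hölder cocycle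
    (A : X → M ≃ₜ M) (hA : ∀ x, D.MemDiff k γ (A x))
    (c : ℝ) (hc : ∀ x y, D.diffDist k γ (A x) (A y) ≤ ENNReal.ofReal (c * dist x y ^ β))
    -- bunching
    (K η : ℝ) (hη : 0 < η) (hbunch : η ^ (2 * (r + 1)) * lam ^ (β * (q - r)) < 1)
    (hK : ∀ x, ∀ n : ℕ, 1 ≤ n → D.size k γ (cocycleIter f A n x) ≤ ENNReal.ofReal (K * η ^ n)) :
    ∃ H : X → X → (M ≃ₜ M),
      -- the limits exist in `Diff^r(M)`
      (∀ x, ∀ y ∈ Ws x, D.MemDiff k (r - k) (H x y) ∧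
        Tendsto (fun n : ℕ => D.diffDist k (r - k)
          ((cocycleIter f A n y)⁻¹ * cocycleIter f A n x) (H x y)) atTop (𝓝 0)) ∧
      -- (H1)
      (∀ x, H x x = 1) ∧
      (∀ x, ∀ y ∈ Ws x, ∀ z ∈ Ws x, H y z * H x y = H x z) ∧
      (∀ x, ∀ y ∈ Ws x, (H x y)⁻¹ = H y x) ∧
      -- (H2)
      (∀ x, ∀ y ∈ Ws x, ∀ n : ℕ,
        H x y = (cocycleIter f A n y)⁻¹ * H (f^[n] x) (f^[n] y) * cocycleIter f A n x) ∧
      -- (H3)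
      (∃ c₁ : ℝ, ∀ x, ∀ y ∈ Wloc x,
        D.diffDist k (r - k) (H x y) 1 ≤ ENNReal.ofReal (c₁ * dist x y ^ (β * (q - r)))) ∧
      -- (H4)
      (∀ x, ∀ y ∈ Wloc x,
        Tendsto (fun p : X × X => D.diffDist k (r - k) (H p.1 p.2) (H x y))
          (𝓝[{p : X × X | p.2 ∈ Wloc p.1}] (x, y)) (𝓝 0))
  := by
  have hleaves := hbase.hasContractingLeaves
  have hρ : q - r = γ - (r - k) := by rw [hq]; ring
  have hbunch' := rpow_mul_rpow_lt_one_of_le (p := k + (r - k) + 1) hη.le hleaves.rate_pos.le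
    hleaves.rate_lt_one (mul_pos hβ (sub_pos.2 hrq))
    (by linarith [k.cast_nonneg (α := ℝ)]) (by linarith [k.cast_nonneg (α := ℝ)]) hbunch
  rw [hρ] at hbunch' ⊢
  exact proposition3p3_general f.continuous hleaves D hk (sub_nonneg.2 hkr) (by linarith) hγ' hβ hA
    hc hη.le hbunch' hK
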